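/- Let $\Omega\subset\mathbb{R}^3$ be a bounded, open, connected set with Lipschitz-continuous boundary $\Gamma$ and outward unit normal $\mathbf n$, and let $\omega>0$. Let $\varepsilon,\sigma,\mu$ be bounded, measurable, strictly positive real fields on $\Omega$, put $\varepsilon_c:=\varepsilon+\imath\sigma/\omega$, and let $\alpha$ be a bounded, measurable complex field on $\Gamma$; assume that $\mu$, $|\varepsilon_c|$ and $|\alpha|$ are bounded away from zero almost everywhere. Write $\varepsilon_c=|\varepsilon_c|e^{\imath\varphi_\varepsilon}$ and $\alpha=|\alpha|e^{\imath\varphi_\alpha}$ with real phases $\varphi_\varepsilon,\varphi_\alpha$. Let $\gamma^T$ be the tangential trace, i.e. the extension of $\mathbf v\mapsto(\mathbf v\times\mathbf n)_{|\Gamma}$, and let $$\mathbf H^+(\mathbf{curl},\Omega)=\{\mathbf v\in\mathbf L^2(\Omega):\ \mathbf{curl}\,\mathbf v\in\mathbf L^2(\Omega),\ \gamma^T\mathbf v\in\mathbf L^2_t(\Gamma)\},\qquad \|\mathbf v\|^2_{\mathbf H^+}=\|\mathbf v\|^2_{\mathbf L^2(\Omega)}+\|\mathbf{curl}\,\mathbf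 v\|^2_{\mathbf L^2(\Omega)}+\|\gamma^T\mathbf v\|^2_{\mathbf L^2(\Gamma)},$$ where $\mathbf L^2_t(\Gamma)$ is the set of tangential fields in $\mathbf L^2(\Gamma)$. Consider on this space the isotropic Robin form $$a^+(\mathbf u,\mathbf v)=(\mu^{-1}\mathbf{curl}\,\mathbf u,\mathbf{curl}\,\mathbf v)_\Omega-\omega^2(\varepsilon_c\mathbf u,\mathbf v)_\Omega-(\alpha\,\gamma^T\mathbf u,\gamma^T\mathbf v)_\Gamma .$$ An angle $\theta\in[-\pi,\pi]$ is a coercivity direction of $a^+$ if there is $C>0$ with $\Re\{-e^{\imath\theta}a^+(\mathbf u,\mathbf u)\}\ge C\|\mathbf u\|_{\mathbf H^+}^2$ for all $\mathbf u\in\mathbf H^+(\mathbf{curl},\Omega)$; let $\Theta_{\mathrm{coe}}$ be the set of all coercivity directions. For a scalar field $\xi$, let $\Theta_\xi$ be the set of all $\theta\in[-\pi,\pi]$ for which there is $c>0$ with $\Re\{e^{\imath\theta}\xi\}\ge c$ almost everywhere. Assume that $\varphi_\varepsilon\in[\varphi_{\varepsilon,-},\varphi_{\varepsilon,+}]$ a.e.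 in $\Omega$ and $\varphi_\alpha\in[\varphi_{\alpha,-},\varphi_{\alpha,+}]$ a.e. on $\Gamma$, where $0<\varphi_{\varepsilon,-}\le\varphi_{\varepsilon,+}<\pi/2$, $0<\varphi_{\alpha,-}\le\varphi_{\alpha,+}<\pi+\varphi_{\varepsilon,-}$ and $\varphi_{\alpha,+}-\varphi_{\alpha,-}<\pi$. Put $$I:=\big]-\tfrac{\pi}{2}-\min(\varphi_{\varepsilon,-},\varphi_{\alpha,-}),\ -\tfrac{\pi}{2}-\max(0,\varphi_{\alpha,+}-\pi)\big[ .$$ Then $a^+$ is coercive in every direction $\theta\in I$, that is, $I\subseteq\Theta_{\mathrm{coe}}$; more precisely, $$I\ \subseteq\ \Theta_{\varepsilon_c}\cap\Theta_{-\mu^{-1}}\cap\Theta_\alpha\ \subseteq\ \Theta_{\mathrm{coe}} .$$ If in addition $\varphi_{\varepsilon,-}$ and $\varphi_{\alpha,-}$ are the minima of $\varphi_\varepsilon$ on $\Omega$ and of $\varphi_\alpha$ on $\Gamma$, and $\varphi_{\alpha,+}$ is the maximum of $\varphi_\alpha$ on $\Gamma$ (in the essential sense: the greatest a.e. lower bounds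 and the least a.e. upper bound), then $$\Theta_{\mathrm{coe}}\ =\ \Theta_{\varepsilon_c}\cap\Theta_{-\mu^{-1}}\cap\Theta_\alpha\ =\ I .$$ -/

import Mathlib

open MeasureTheory Set Filter Topology


noncomputable section

namespace Maxwell

/-- Euclidean space `ℝ³`. -/
abbrev E3 : Type := EuclideanSpace ℝ (Fin 3)

/-- Complex vectors `ℂ³` with the Hermitian norm. -/
abbrev C3 : Type := EuclideanSpace ℂ (Fin 3)

/-! ### Lipschitz domains, surface measure, outward normal -/

/-- The boundary of `Ω` is Lipschitz continuous: near every boundary point, in suitable orthonormal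
coordinates `(y', y₃) ∈ ℝ² × ℝ`, the set `Ω` is the strict subgraph `y₃ < f(y')` of a Lipschitz
function `f`. -/
def HasLipschitzBoundary (Ω : Set E3) : Prop :=
  ∀ x ∈ frontier Ω,
    ∃ (L : E3 ≃ₗᵢ[ℝ] WithLp 2 (EuclideanSpace ℝ (Fin 2) × ℝ))
      (f : EuclideanSpace ℝ (Fin 2) → ℝ) (K : NNReal),
      LipschitzWith K f ∧ ∀ᶠ y in 𝓝 x, (y ∈ Ω ↔ (L y).snd < f (L y).fst)

/-- The surface measure on `Γ = ∂Ω`: the two-dimensional Hausdorff measure (normalised so as to give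
the usual area on planes) restricted to `Γ`. -/
def surfaceMeasure (Ω : Set E3) : Measure E3 :=
  (Measure.euclideanHausdorffMeasure 2).restrict (frontier Ω)

/-- `ν` is the outward unit normal to `∂Ω` at `x` in the classical sense: near `x`, every cone
around `-ν` with opening less than a half-space lies in `Ω`, and every such cone around `ν` lies in
the complement of `Ω`. At a given boundary point there is at most one such `ν`. -/
def IsOutwardUnitNormal (Ω : Set E3) (x ν : E3) : Prop :=
  ‖ν‖ = 1 ∧ ∀ η : ℝ, 0 < η → ∀ᶠ y in 𝓝 x,
    (inner ℝ (y - x) ν < -η * ‖y - x‖ → y ∈ Ω) ∧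
    (η * ‖y - x‖ < inner ℝ (y - x) ν → y ∉ Ω)

open Classical in
/-- The outward unit normal `n` on `∂Ω`. On a Lipschitz boundary it exists at almost every point;
where it does not exist we put `n = 0`. -/
def outwardNormal (Ω : Set E3) (x : E3) : E3 :=
  if h : ∃ ν, IsOutwardUnitNormal Ω x ν then h.choose else 0

/-! ### Differential operators and function spaces -/

/-- The partial derivative `∂ⱼ vᵢ`. -/
def partialDeriv (v : E3 → C3) (j i : Fin 3) (x : E3) : ℂ :=
  fderiv ℝ v x (EuclideanSpace.single j 1) i

/-- The classical `curl` of a differentiable vector field. -/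
def curl (v : E3 → C3) (x : E3) : C3 :=
  !₂[partialDeriv v 1 2 x - partialDeriv v 2 1 x,
     partialDeriv v 2 0 x - partialDeriv v 0 2 x,
     partialDeriv v 0 1 x - partialDeriv v 1 0 x]

/-- The vector product `z × n` of a complex vector and a real vector. -/
def crossReal (z : C3) (n : E3) : C3 :=
  !₂[z 1 * n 2 - z 2 * n 1, z 2 * n 0 - z 0 * n 2, z 0 * n 1 - z 1 * n 0]

/-- `C_c^∞(ℝ³; ℂ³)`; the restrictions to `Ω` of these fields are the fields that are smooth up to
the boundary of the bounded set `Ω`. -/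
def IsSmoothField (v : E3 → C3) : Prop :=
  ContDiff ℝ ((⊤ : ℕ∞) : WithTop ℕ∞) v ∧ HasCompactSupport v

/-- `L²(Ω; ℂ³)`. -/
abbrev L2Vol (Ω : Set E3) : Type := Lp C3 2 (volume.restrict Ω)

/-- `L²(Γ; ℂ³)` with `Γ = ∂Ω`. -/
abbrev L2Sur (Ω : Set E3) : Type := Lp C3 2 (surfaceMeasure Ω)

/-- `w = curl u` in `Ω` in the weak sense: `(u, curl φ)_Ω = (w, φ)_Ω` for all test fields
`φ ∈ C_c^∞(Ω; ℂ³)`. (`Φ` and `Ψ` are `φ` and `curl φ` as elements of `L²`; Mathlib's inner product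
is conjugate-linear in its first argument.) -/
def IsWeakCurl (Ω : Set E3) (u w : L2Vol Ω) : Prop :=
  ∀ φ : E3 → C3, IsSmoothField φ → tsupport φ ⊆ Ω →
    ∀ Φ Ψ : L2Vol Ω, Φ =ᵐ[volume.restrict Ω] φ → Ψ =ᵐ[volume.restrict Ω] curl φ →
      inner ℂ Ψ u = inner ℂ Φ w

/-- `A`, `B`, `G` are the classes in `L²(Ω)`, `L²(Ω)`, `L²(Γ)` of `v`, of `curl v` and of
`(v × n)|_Γ`, for one and the same field `v` that is smooth up to the boundary. -/
def IsSmoothTriple (Ω : Set E3) (A B : L2Vol Ω) (G : L2Sur Ω) : Prop :=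
  ∃ v : E3 → C3, IsSmoothField v ∧
    A =ᵐ[volume.restrict Ω] v ∧ B =ᵐ[volume.restrict Ω] curl v ∧
    G =ᵐ[surfaceMeasure Ω] fun x => crossReal (v x) (outwardNormal Ω x)

/-- The tangential trace `γ^T u` of `u ∈ H(curl, Ω)`, `w = curl u`, is the element `g` of `L²(Γ)`.
Here `γ^T` is the extension by continuity of `v ↦ (v × n)|_Γ` from fields smooth up to the boundary
(which are dense) to `H(curl, Ω)`, with values in a space of distributions on `Γ`: `γ^T u` is the
limit, tested against smooth fields, of `(vₖ × n)|_Γ` where the `vₖ` are smooth and converge to `u`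
in `H(curl, Ω)`. -/
def HasTangentialTrace (Ω : Set E3) (u w : L2Vol Ω) (g : L2Sur Ω) : Prop :=
  ∃ (A B : ℕ → L2Vol Ω) (G : ℕ → L2Sur Ω),
    (∀ k, IsSmoothTriple Ω (A k) (B k) (G k)) ∧
    Tendsto A atTop (𝓝 u) ∧ Tendsto B atTop (𝓝 w) ∧
    ∀ φ : E3 → C3, IsSmoothField φ → ∀ Φ : L2Sur Ω, Φ =ᵐ[surfaceMeasure Ω] φ →
      Tendsto (fun k => inner ℂ Φ (G k)) atTop (𝓝 (inner ℂ Φ g))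

/-- `g · n = 0` almost everywhere on `Γ`, i.e. `g ∈ L²_t(Γ)`. -/
def IsTangential (Ω : Set E3) (g : L2Sur Ω) : Prop :=
  ∀ᵐ x ∂surfaceMeasure Ω, ∑ i, g x i * (outwardNormal Ω x i : ℂ) = 0

theorem partialDeriv_add {v w : E3 → C3} (hv : IsSmoothField v) (hw : IsSmoothField w)
    (j i : Fin 3) (x : E3) :
    partialDeriv (v + w) j i x = partialDeriv v j i x + partialDeriv w j i x := by
  have h1 : DifferentiableAt ℝ v x := (hv.1.differentiable (by simp)) x
  have h2 : DifferentiableAt ℝ w x := (hw.1.differentiable (by simp)) x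
  simp [partialDeriv, fderiv_add h1 h2]

theorem partialDeriv_smul {v : E3 → C3} (hv : IsSmoothField v) (c : ℂ)
    (j i : Fin 3) (x : E3) :
    partialDeriv (c • v) j i x = c * partialDeriv v j i x := by
  have h1 : DifferentiableAt ℝ v x := (hv.1.differentiable (by simp)) x
  simp [partialDeriv, fderiv_const_smul h1 c]

theorem curl_add {v w : E3 → C3} (hv : IsSmoothField v) (hw : IsSmoothField w) :
    curl (v + w) = curl v + curl w := by
  funext x
  ext i
  fin_cases i <;> simp [curl, partialDeriv_add hv hw] <;> ring

theorem curl_smul {v : E3 → C3} (hv : IsSmoothField v) (c : ℂ) :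
    curl (c • v) = c • curl v := by
  funext x
  ext i
  fin_cases i <;> simp [curl, partialDeriv_smul hv] <;> ring

theorem IsSmoothTriple.add {Ω : Set E3} {A A' B B' : L2Vol Ω} {G G' : L2Sur Ω}
    (h : IsSmoothTriple Ω A B G) (h' : IsSmoothTriple Ω A' B' G') :
    IsSmoothTriple Ω (A + A') (B + B') (G + G') := by
  obtain ⟨v, hv, hA, hB, hG⟩ := h
  obtain ⟨v', hv', hA', hB', hG'⟩ := h'
  refine ⟨v + v', ⟨hv.1.add hv'.1, hv.2.add hv'.2⟩, ?_, ?_, ?_⟩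
  · exact (Lp.coeFn_add A A').trans (hA.add hA')
  · rw [curl_add hv hv']
    exact (Lp.coeFn_add B B').trans (hB.add hB')
  · refine (Lp.coeFn_add G G').trans ((hG.add hG').trans (Eventually.of_forall fun x => ?_))
    ext i
    fin_cases i <;> simp [crossReal] <;> ring

theorem IsSmoothTriple.smul {Ω : Set E3} {A B : L2Vol Ω} {G : L2Sur Ω} (c : ℂ)
    (h : IsSmoothTriple Ω A B G) : IsSmoothTriple Ω (c • A) (c • B) (c • G) := by
  obtain ⟨v, hv, hA, hB, hG⟩ := h
  refine ⟨c • v, ⟨hv.1.const_smul c, hv.2.smul_left (f := fun _ => c)⟩, ?_, ?_, ?_⟩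
  · exact (Lp.coeFn_smul c A).trans (hA.const_smul c)
  · rw [curl_smul hv]
    exact (Lp.coeFn_smul c B).trans (hB.const_smul c)
  · refine (Lp.coeFn_smul c G).trans ((hG.const_smul c).trans (Eventually.of_forall fun x => ?_))
    ext i
    fin_cases i <;> simp [crossReal] <;> ring

theorem isSmoothTriple_zero (Ω : Set E3) : IsSmoothTriple Ω 0 0 0 := by
  have hz : IsSmoothField (0 : E3 → C3) := ⟨contDiff_const, HasCompactSupport.zero⟩
  refine ⟨0, hz, Lp.coeFn_zero _ _ _, ?_, ?_⟩
  · have : curl (0 : E3 → C3) = 0 := by simpa using curl_smul hz 0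
    rw [this]
    exact Lp.coeFn_zero _ _ _
  · refine (Lp.coeFn_zero _ _ _).trans (Eventually.of_forall fun x => ?_)
    ext i
    fin_cases i <;> simp [crossReal]

/-- The space `H⁺(curl, Ω)`: fields `u ∈ L²(Ω)` with `curl u ∈ L²(Ω)` and `γ^T u ∈ L²_t(Γ)`. An
element is stored together with its curl and its trace, as the triple `(u, curl u, γ^T u)`; the norm
inherited from the Hilbert direct sum is
`(‖u‖²_{L²(Ω)} + ‖curl u‖²_{L²(Ω)} + ‖γ^T u‖²_{L²(Γ)})^{1/2}`. -/
def HPlusCurl (Ω : Set E3) :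
    Submodule ℂ (WithLp 2 (L2Vol Ω × WithLp 2 (L2Vol Ω × L2Sur Ω))) where
  carrier := {p | IsWeakCurl Ω p.fst p.snd.fst ∧
    HasTangentialTrace Ω p.fst p.snd.fst p.snd.snd ∧ IsTangential Ω p.snd.snd}
  add_mem' := by
    rintro p q ⟨h1, ⟨A, B, G, hs, hA, hB, hG⟩, h3⟩ ⟨h1', ⟨A', B', G', hs', hA', hB', hG'⟩, h3'⟩
    refine ⟨?_, ⟨A + A', B + B', G + G', fun k => (hs k).add (hs' k), hA.add hA', hB.add hB', ?_⟩,
      ?_⟩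
    · intro φ hφ hsupp Φ Ψ hΦ hΨ
      simp [inner_add_right, h1 φ hφ hsupp Φ Ψ hΦ hΨ, h1' φ hφ hsupp Φ Ψ hΦ hΨ]
    · intro φ hφ Φ hΦ
      simpa [inner_add_right] using (hG φ hφ Φ hΦ).add (hG' φ hφ Φ hΦ)
    · filter_upwards [h3, h3', Lp.coeFn_add p.snd.snd q.snd.snd] with x hx hx' hadd
      have e : ((p + q).snd.snd : L2Sur Ω) = p.snd.snd + q.snd.snd := by simp
      rw [e, hadd]
      simp only [Pi.add_apply, PiLp.add_apply, add_mul, Finset.sum_add_distrib, hx, hx', add_zero]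
  zero_mem' := by
    refine ⟨?_, ⟨0, 0, 0, fun k => isSmoothTriple_zero Ω, tendsto_const_nhds, tendsto_const_nhds,
      ?_⟩, ?_⟩
    · intro φ hφ hsupp Φ Ψ hΦ hΨ
      simp
    · intro φ hφ Φ hΦ
      simp
    · filter_upwards [Lp.coeFn_zero C3 2 (surfaceMeasure Ω)] with x hx
      have e : ((0 : WithLp 2 (L2Vol Ω × WithLp 2 (L2Vol Ω × L2Sur Ω))).snd.snd : L2Sur Ω) = 0 := by
        simp
      rw [e, hx]
      simp
  smul_mem' := by
    rintro c p ⟨h1, ⟨A, B, G, hs, hA, hB, hG⟩, h3⟩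
    refine ⟨?_, ⟨c • A, c • B, c • G, fun k => (hs k).smul c, hA.const_smul c, hB.const_smul c, ?_⟩,
      ?_⟩
    · intro φ hφ hsupp Φ Ψ hΦ hΨ
      simp [inner_smul_right, h1 φ hφ hsupp Φ Ψ hΦ hΨ]
    · intro φ hφ Φ hΦ
      simpa [inner_smul_right] using (hG φ hφ Φ hΦ).const_mul c
    · filter_upwards [h3, Lp.coeFn_smul c p.snd.snd] with x hx hsm
      have e : ((c • p).snd.snd : L2Sur Ω) = c • p.snd.snd := by simp
      rw [e, hsm]
      simp only [Pi.smul_apply, PiLp.smul_apply, smul_eq_mul, mul_assoc, ← Finset.mul_sum, hx,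
        mul_zero]

/-- The field `u` itself. -/
def fieldOf {Ω : Set E3} (u : HPlusCurl Ω) : L2Vol Ω := u.1.fst

/-- The weak curl of `u`. -/
def curlOf {Ω : Set E3} (u : HPlusCurl Ω) : L2Vol Ω := u.1.snd.fst

/-- The tangential trace `γ^T u`. -/
def traceOf {Ω : Set E3} (u : HPlusCurl Ω) : L2Sur Ω := u.1.snd.snd

theorem HPlusCurl_norm_sq {Ω : Set E3} (u : HPlusCurl Ω) :
    ‖u‖ ^ 2 = ‖fieldOf u‖ ^ 2 + ‖curlOf u‖ ^ 2 + ‖traceOf u‖ ^ 2 := by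
  rw [Submodule.coe_norm, WithLp.prod_norm_sq_eq_of_L2, WithLp.prod_norm_sq_eq_of_L2, add_assoc]
  rfl

/-! ### The Robin form of an isotropic lossy medium, ellipticity and coercivity -/

/-- The complex dielectric field `ε_c = ε + i σ / ω`. -/
def dielectric (ω : ℝ) (ε σ : E3 → ℝ) (x : E3) : ℂ :=
  (ε x : ℂ) + Complex.I * (σ x : ℂ) / (ω : ℂ)

/-- The isotropic Robin form
`a⁺(u, v) = (μ⁻¹ curl u, curl v)_Ω - ω² (ε_c u, v)_Ω - (α γ^T u, γ^T v)_Γ`. -/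
def robinForm (Ω : Set E3) (ω : ℝ) (μ : E3 → ℝ) (εc α : E3 → ℂ) (u v : HPlusCurl Ω) : ℂ :=
  (∫ x in Ω, ((μ x)⁻¹ : ℂ) * inner ℂ (curlOf v x) (curlOf u x))
    - (ω : ℂ) ^ 2 * (∫ x in Ω, εc x * inner ℂ (fieldOf v x) (fieldOf u x))
    - ∫ x, α x * inner ℂ (traceOf v x) (traceOf u x) ∂surfaceMeasure Ω

/-- The form `a` is coercive in the direction `θ`. -/
def IsCoerciveInDirection {V : Type*} [NormedAddCommGroup V] (a : V → V → ℂ) (θ : ℝ) : Prop :=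
  ∃ C : ℝ, 0 < C ∧ ∀ u : V,
    C * ‖u‖ ^ 2 ≤ (-Complex.exp (Complex.I * (θ : ℂ)) * a u u).re

/-- The set of all coercivity directions of `a`, written in the range `[-π, π]`. -/
def coercivityDirections {V : Type*} [NormedAddCommGroup V] (a : V → V → ℂ) : Set ℝ :=
  {θ | θ ∈ Icc (-Real.pi) Real.pi ∧ IsCoerciveInDirection a θ}

/-- The `Θ`-set of a scalar field `ξ`: all ellipticity directions in the range `[-π, π]`. -/
def thetaSet (m : Measure E3) (ξ : E3 → ℂ) : Set ℝ :=
  {θ | θ ∈ Icc (-Real.pi) Real.pi ∧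
    ∃ c : ℝ, 0 < c ∧ ∀ᵐ x ∂m, c ≤ (Complex.exp (Complex.I * (θ : ℂ)) * ξ x).re}

/-- `a` is the (essential) minimum of `φ`: the greatest almost everywhere lower bound. -/
def IsEssMin (m : Measure E3) (φ : E3 → ℝ) (a : ℝ) : Prop :=
  IsGreatest {c : ℝ | ∀ᵐ x ∂m, c ≤ φ x} a

/-- `a` is the (essential) maximum of `φ`: the least almost everywhere upper bound. -/
def IsEssMax (m : Measure E3) (φ : E3 → ℝ) (a : ℝ) : Prop :=
  IsLeast {c : ℝ | ∀ᵐ x ∂m, φ x ≤ c} a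

end Maxwell

end

open Maxwell

noncomputable section
namespace Maxwell

/-! ### Outward normal and surface measure of a Lipschitz boundary -/

/-! On the diagonal, `Re(-e^{iθ} a⁺(u,u))` is a sum of three weighted energies, with weights
`Re(-e^{iθ}/μ)` on `|curl u|²`, `ω² Re(e^{iθ} ε_c)` on `|u|²` and `Re(e^{iθ} α)` on `|γᵀu|²`
(`re_robinForm`). Uniformly positive weights therefore give coercivity. Writing `Re(e^{iθ} ξ) = |ξ|
cos(θ + φ)`, a direction in the interval `I` keeps `θ + φ` inside a compact part of `]-π/2, π/2[`
for `ε_c` and `α`, and makes `cos θ` negative for `-1/μ`.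

Conversely, a coercivity estimate has to be localized to the weights. The gradients `∇(ψ e^{iN
x_k})/N` are curl free, and as `N → ∞` their squared size tends to `ψ²` in `Ω`, that of their trace
to `ψ²(|n|² - n_k²)` on `Γ`. Summing over the three axes removes the dependence on the normal and
leaves `3ψ²` and `2ψ²`. Since `Ω` and `Γ` are disjoint, one localization argument for the sum of the
volume and surface measures yields both weight bounds (`ae_nonneg_of_curl_free`). For the curl
weight, the transverse waves `ψ e^{iN x₀} e₁` have curl energy of order `N²` but bounded mass, which
forces `cos θ < 0` (`re_neg_of_coercive`). Lower bounds on the cosines then keep the phases a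
positive distance away from `±π/2`, and extremality of the phase bounds turns this into the strict
inequalities defining `I`.

The traces require a finite surface measure and a measurable normal that is a unit vector almost
everywhere. Both come from Rademacher's theorem in Lipschitz charts and compactness of `Γ`
(`hasGoodNormalOn_frontier`). -/

theorem IsOutwardUnitNormal.unique {Ω : Set E3} {x ν ν' : E3} (h : IsOutwardUnitNormal Ω x ν)
    (h' : IsOutwardUnitNormal Ω x ν') : ν = ν' := by
  by_contra hne
  -- This direction makes an obtuse angle with `ν` and an acute one with `ν'`, so `x + t e` for
  -- small `t > 0` would lie both inside and outside `Ω`.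
  set e : E3 := ν' - ν with he
  have he0 : 0 < ‖e‖ := norm_pos_iff.2 (sub_ne_zero.2 (Ne.symm hne))
  have hsq : ‖e‖ ^ 2 = 2 - 2 * inner ℝ ν ν' := by
    rw [he, norm_sub_sq_real, h.1, h'.1, real_inner_comm]; ring
  have h1 : inner ℝ e ν = -(‖e‖ ^ 2 / 2) := by
    rw [hsq, he, inner_sub_left, real_inner_self_eq_norm_sq, h.1, real_inner_comm]; ring
  have h2 : inner ℝ e ν' = ‖e‖ ^ 2 / 2 := by
    rw [hsq, he, inner_sub_left, real_inner_self_eq_norm_sq, h'.1]; ring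
  -- Any aperture below `‖e‖ / 2`, the modulus of both cosines, would do.
  have hη : 0 < ‖e‖ / 4 := by positivity
  have hlim : Tendsto (fun t : ℝ => x + t • e) (𝓝[>] 0) (𝓝 x) := by
    have : Tendsto (fun t : ℝ => x + t • e) (𝓝 0) (𝓝 (x + (0 : ℝ) • e)) := by
      apply Continuous.tendsto; fun_prop
    simpa using this.mono_left nhdsWithin_le_nhds
  have hev := (hlim.eventually ((h.2 _ hη).and (h'.2 _ hη))).and self_mem_nhdsWithin
  obtain ⟨t, ⟨ha, hb⟩, ht⟩ := hev.exists
  have ht' : (0 : ℝ) < t := ht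
  have hn : ‖x + t • e - x‖ = t * ‖e‖ := by
    rw [add_sub_cancel_left, norm_smul, Real.norm_of_nonneg ht'.le]
  rw [hn, add_sub_cancel_left, inner_smul_left, h1] at ha
  rw [hn, add_sub_cancel_left, inner_smul_left, h2] at hb
  have hpos : 0 < t * ‖e‖ ^ 2 := by positivity
  refine hb.2 ?_ (ha.1 ?_)
  · simp only [conj_trivial]; nlinarith
  · simp only [conj_trivial]; nlinarith

theorem outwardNormal_eq {Ω : Set E3} {x ν : E3} (h : IsOutwardUnitNormal Ω x ν) :
    outwardNormal Ω x = ν := by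
  have hex : ∃ ν, IsOutwardUnitNormal Ω x ν := ⟨ν, h⟩
  rw [outwardNormal, dif_pos hex]
  exact hex.choose_spec.unique h

theorem norm_outwardNormal_le (Ω : Set E3) (x : E3) : ‖outwardNormal Ω x‖ ≤ 1 := by
  unfold outwardNormal
  split_ifs with h
  · exact h.choose_spec.1.le
  · simp

/-- The unit normal of the graph of `f`, in the coordinates `L`, over the foot point of `y`. -/
def graphNormal (L : E3 ≃ₗᵢ[ℝ] WithLp 2 (EuclideanSpace ℝ (Fin 2) × ℝ))
    (f : EuclideanSpace ℝ (Fin 2) → ℝ) (y : E3) : E3 :=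
  (√(1 + ‖gradient f (L y).fst‖ ^ 2))⁻¹ •
    L.symm (WithLp.toLp 2 (-gradient f (L y).fst, (1 : ℝ)))

/-- The parametrization of the graph of `f` in the coordinates `L`. -/
def graphMap (L : E3 ≃ₗᵢ[ℝ] WithLp 2 (EuclideanSpace ℝ (Fin 2) × ℝ))
    (f : EuclideanSpace ℝ (Fin 2) → ℝ) (z : EuclideanSpace ℝ (Fin 2)) : E3 :=
  L.symm (WithLp.toLp 2 (z, f z))

section Graph

variable (L : E3 ≃ₗᵢ[ℝ] WithLp 2 (EuclideanSpace ℝ (Fin 2) × ℝ))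
  (f : EuclideanSpace ℝ (Fin 2) → ℝ)

theorem measurable_graphNormal : Measurable (graphNormal L f) := by
  have hg : Measurable (gradient f) :=
    (InnerProductSpace.toDual ℝ (EuclideanSpace ℝ (Fin 2))).symm.continuous.measurable.comp
      (measurable_fderiv ℝ f)
  have hz : Measurable fun y : E3 => (L y).fst :=
    (Continuous.measurable (by fun_prop) : Measurable fun y : E3 => (L y).fst)
  have h1 : Measurable fun y : E3 => gradient f (L y).fst := hg.comp hz
  have h2 : Measurable fun w : EuclideanSpace ℝ (Fin 2) => L.symm (WithLp.toLp 2 (-w, (1 : ℝ))) :=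
    Continuous.measurable (by fun_prop)
  have h3 := h2.comp h1
  unfold graphNormal
  exact ((h1.norm.pow_const 2).const_add 1).sqrt.inv.smul h3

theorem norm_graphNormal (y : E3) : ‖graphNormal L f y‖ = 1 := by
  have h : ‖L.symm (WithLp.toLp 2 (-gradient f (L y).fst, (1 : ℝ)))‖
      = √(1 + ‖gradient f (L y).fst‖ ^ 2) := by
    rw [LinearIsometryEquiv.norm_map, WithLp.prod_norm_eq_of_L2]
    simp [add_comm]
  have hpos : 0 < √(1 + ‖gradient f (L y).fst‖ ^ 2) := by positivity
  rw [graphNormal, norm_smul, h, norm_inv, Real.norm_of_nonneg hpos.le, inv_mul_cancel₀ hpos.ne']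

/-- Up to the factor `s`, the component of `w - y` along the normal is the vertical increment minus
the linearized increment of `f`. By differentiability it differs from the height of `w` above the
graph by `o(‖w - y‖)`, so outside the cone of aperture `η` both have the same sign. The bound `s ≥
1` lets the same `η` serve after multiplication by `s`. -/
theorem isOutwardUnitNormal_graphNormal {Ω : Set E3} {y : E3}
    (hy : (L y).snd = f (L y).fst) (hf : DifferentiableAt ℝ f (L y).fst)
    (hloc : ∀ᶠ w in 𝓝 y, (w ∈ Ω ↔ (L w).snd < f (L w).fst)) :
    IsOutwardUnitNormal Ω y (graphNormal L f y) := by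
  refine ⟨norm_graphNormal L f y, fun η hη => ?_⟩
  set z := (L y).fst with hz
  set s := √(1 + ‖gradient f z‖ ^ 2) with hs
  have hs1 : 1 ≤ s := by
    rw [hs]; exact Real.one_le_sqrt.2 (by nlinarith [sq_nonneg ‖gradient f z‖])
  have hs0 : 0 < s := by linarith
  have hlim : Tendsto (fun w : E3 => (L w).fst) (𝓝 y) (𝓝 z) := by
    apply Continuous.tendsto; fun_prop
  have hd := hlim.eventually
    ((hasFDerivAt_iff_isLittleO.1 hf.hasFDerivAt).bound hη)
  filter_upwards [hd, hloc] with w hw hwΩ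
  have hinner : inner ℝ (w - y) (graphNormal L f y)
      = s⁻¹ * (((L w).snd - (L y).snd) - fderiv ℝ f z ((L w).fst - z)) := by
    rw [graphNormal, inner_smul_right, ← LinearIsometryEquiv.inner_map_map L,
      LinearIsometryEquiv.apply_symm_apply, WithLp.prod_inner_apply]
    rw [map_sub, ← hz, ← hs, ← inner_gradient_left]
    simp only [inner_neg_right, real_inner_comm]
    simp
    left; ring
  have hle : ‖(L w).fst - z‖ ≤ ‖w - y‖ := by
    have : ‖L (w - y)‖ = ‖w - y‖ := L.norm_map _
    rw [← this, map_sub]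
    exact WithLp.norm_fst_le _ (L w - L y)
  have hmul : s * inner ℝ (w - y) (graphNormal L f y)
      = ((L w).snd - (L y).snd) - fderiv ℝ f z ((L w).fst - z) := by
    rw [hinner, mul_inv_cancel_left₀ hs0.ne']
  rw [Real.norm_eq_abs, abs_le] at hw
  have hηle : η * ‖(L w).fst - z‖ ≤ s * (η * ‖w - y‖) := by
    have : η * ‖(L w).fst - z‖ ≤ η * ‖w - y‖ := by gcongr
    have h0 : 0 ≤ η * ‖w - y‖ := by positivity
    nlinarith
  rw [hwΩ]
  constructor
  · intro h
    have := mul_lt_mul_of_pos_left h hs0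
    rw [hmul] at this
    linarith [hw.1]
  · intro h
    have := mul_lt_mul_of_pos_left h hs0
    rw [hmul] at this
    rw [not_lt]
    linarith [hw.2]

variable {f}

theorem lipschitzWith_graphMap {K : NNReal} (hf : LipschitzWith K f) :
    LipschitzWith (1 + K) (graphMap L f) := by
  refine LipschitzWith.of_dist_le_mul fun z w => ?_
  rw [graphMap, graphMap, LinearIsometryEquiv.dist_map, WithLp.prod_dist_eq_of_L2]
  have h := hf.dist_le_mul z w
  have h0 : 0 ≤ dist z w := dist_nonneg
  have h1 : 0 ≤ dist (f z) (f w) := dist_nonneg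
  simp only [NNReal.coe_add, NNReal.coe_one]
  calc √(dist z w ^ 2 + dist (f z) (f w) ^ 2) ≤ dist z w + dist (f z) (f w) := by
        rw [Real.sqrt_le_left (by positivity)]; nlinarith
    _ ≤ (1 + K) * dist z w := by linarith

theorem euclideanHausdorffMeasure_graphMap_image {K : NNReal} (hf : LipschitzWith K f) :
    ∃ c : NNReal, ∀ s, Measure.euclideanHausdorffMeasure 2 (graphMap L f '' s) ≤ c * volume s := by
  refine ⟨(1 + K) ^ 2, fun s => ?_⟩
  have h := (lipschitzWith_graphMap L hf).hausdorffMeasure_image_le (d := 2) (by norm_num) s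
  -- Parameter plane and graph are both measured in dimension two, so the same normalizing factor
  -- appears on both sides and factors out.
  have hv : (volume : Measure (EuclideanSpace ℝ (Fin 2)))
      = Measure.euclideanHausdorffMeasure 2 :=
    (EuclideanSpace.euclideanHausdorffMeasure_eq_volume 2).symm
  rw [hv, Measure.euclideanHausdorffMeasure_def, Measure.euclideanHausdorffMeasure_def,
    Measure.smul_apply, Measure.smul_apply, ENNReal.smul_def, ENNReal.smul_def, smul_eq_mul,
    smul_eq_mul, mul_left_comm]
  gcongr
  simpa using h

/-- A boundary point strictly below the graph would belong to the open set `Ω`; one strictly above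
would have a neighbourhood missing `Ω`. -/
theorem frontier_subset_graph {Ω : Set E3} (hΩ : IsOpen Ω) (hf : Continuous f) {y : E3}
    (hy : y ∈ frontier Ω) (hloc : ∀ᶠ w in 𝓝 y, (w ∈ Ω ↔ (L w).snd < f (L w).fst)) :
    (L y).snd = f (L y).fst := by
  rw [hΩ.frontier_eq] at hy
  refine le_antisymm ?_ (not_lt.1 fun h => hy.2 (hloc.self_of_nhds.2 h))
  by_contra! h
  have hopen : ∀ᶠ w in 𝓝 y, f (L w).fst < (L w).snd := by
    apply ContinuousAt.eventually_lt _ _ h <;> apply Continuous.continuousAt <;> fun_prop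
  obtain ⟨w, hwΩ, h1, h2⟩ := (mem_closure_iff_frequently.1 hy.1).and_eventually
    (hloc.and hopen) |>.exists
  exact absurd (h1.1 hwΩ) h2.not_gt

end Graph

/-- The Hausdorff measure restricted to `s` is finite and `outwardNormal Ω` is, almost everywhere
on `s`, a measurable field of unit vectors. -/
def HasGoodNormalOn (Ω s : Set E3) : Prop :=
  Measure.euclideanHausdorffMeasure 2 s < ⊤ ∧
    (∀ᵐ x ∂(Measure.euclideanHausdorffMeasure 2 : Measure E3).restrict s,
      ‖outwardNormal Ω x‖ = 1) ∧
    AEStronglyMeasurable (outwardNormal Ω)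
      ((Measure.euclideanHausdorffMeasure 2 : Measure E3).restrict s)

theorem HasGoodNormalOn.mono {Ω s t : Set E3} (h : HasGoodNormalOn Ω t) (hst : s ⊆ t) :
    HasGoodNormalOn Ω s :=
  have hm := Measure.restrict_mono_set (Measure.euclideanHausdorffMeasure 2 : Measure E3) hst
  ⟨(measure_mono hst).trans_lt h.1, ae_mono hm h.2.1, h.2.2.mono_measure hm⟩

theorem HasGoodNormalOn.union {Ω s t : Set E3} (h : HasGoodNormalOn Ω s)
    (h' : HasGoodNormalOn Ω t) : HasGoodNormalOn Ω (s ∪ t) :=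
  ⟨measure_union_lt_top h.1 h'.1, ae_restrict_union_iff _ _ _ |>.2 ⟨h.2.1, h'.2.1⟩,
    aestronglyMeasurable_union_iff.2 ⟨h.2.2, h'.2.2⟩⟩

/-- By Rademacher's theorem `f` is differentiable off a null set, whose image under the Lipschitz
graph map is null for the surface measure. Elsewhere the geometric normal is the explicit measurable
graph normal. Finite area holds because the foot points stay in a ball. -/
theorem hasGoodNormalOn_graph {Ω : Set E3} (hΩ : IsOpen Ω)
    (L : E3 ≃ₗᵢ[ℝ] WithLp 2 (EuclideanSpace ℝ (Fin 2) × ℝ))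
    {f : EuclideanSpace ℝ (Fin 2) → ℝ} {K : NNReal} (hf : LipschitzWith K f) {U : Set E3}
    (hUo : IsOpen U) (hUb : Bornology.IsBounded U)
    (hU : ∀ w ∈ U, (w ∈ Ω ↔ (L w).snd < f (L w).fst)) :
    HasGoodNormalOn Ω (U ∩ frontier Ω) := by
  obtain ⟨c, hc⟩ := euclideanHausdorffMeasure_graphMap_image L hf
  have hloc : ∀ y ∈ U, ∀ᶠ w in 𝓝 y, (w ∈ Ω ↔ (L w).snd < f (L w).fst) := fun y hy => by
    filter_upwards [hUo.mem_nhds hy] with w hw using hU w hw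
  have hgr : ∀ y ∈ U ∩ frontier Ω, (L y).snd = f (L y).fst := fun y hy =>
    frontier_subset_graph L hΩ hf.continuous hy.2 (hloc y hy.1)
  have hmap : ∀ y ∈ U ∩ frontier Ω, graphMap L f (L y).fst = y := fun y hy => by
    rw [graphMap, ← hgr y hy]
    exact L.symm_apply_apply y
  have hfin : Measure.euclideanHausdorffMeasure 2 (U ∩ frontier Ω) < ⊤ := by
    obtain ⟨R, hR⟩ := hUb.subset_closedBall 0
    have hsub : U ∩ frontier Ω ⊆ graphMap L f '' Metric.closedBall 0 R := fun y hy =>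
      ⟨(L y).fst, by
        have h1 : ‖(L y).fst‖ ≤ ‖L y‖ := WithLp.norm_fst_le _ _
        have h2 := hR hy.1
        rw [L.norm_map] at h1
        simp only [mem_closedBall_zero_iff] at h2 ⊢
        exact h1.trans h2, hmap y hy⟩
    exact ((measure_mono hsub).trans (hc _)).trans_lt
      (ENNReal.mul_lt_top ENNReal.coe_lt_top measure_closedBall_lt_top)
  have hmeas : MeasurableSet (U ∩ frontier Ω) :=
    hUo.measurableSet.inter isClosed_frontier.measurableSet
  have hae : ∀ᵐ x ∂(Measure.euclideanHausdorffMeasure 2 : Measure E3).restrict (U ∩ frontier Ω),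
      outwardNormal Ω x = graphNormal L f x := by
    rw [ae_restrict_iff' hmeas]
    have hnull : volume {z | ¬DifferentiableAt ℝ f z} = 0 := hf.ae_differentiableAt
    have h0 : Measure.euclideanHausdorffMeasure 2
        (graphMap L f '' {z | ¬DifferentiableAt ℝ f z}) = 0 :=
      le_antisymm ((hc _).trans (by rw [hnull, mul_zero])) zero_le
    filter_upwards [compl_mem_ae_iff.2 h0] with y hy hyU
    refine outwardNormal_eq (isOutwardUnitNormal_graphNormal L f (hgr y hyU) ?_ (hloc y hyU.1))
    by_contra hnd
    exact hy ⟨(L y).fst, hnd, hmap y hyU⟩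
  refine ⟨hfin, ?_, (measurable_graphNormal L f).aestronglyMeasurable.congr
    (hae.mono fun x hx => hx.symm)⟩
  filter_upwards [hae] with x hx
  rw [hx, norm_graphNormal]

/-- The property passes to subsets and finite unions, so compactness of the boundary reduces it to
one chart. -/
theorem hasGoodNormalOn_frontier {Ω : Set E3} (hΩ : IsOpen Ω) (hb : Bornology.IsBounded Ω)
    (hlip : HasLipschitzBoundary Ω) : HasGoodNormalOn Ω (frontier Ω) := by
  have hcpt : IsCompact (frontier Ω) :=
    Metric.isCompact_of_isClosed_isBounded isClosed_frontier
      (hb.closure.subset frontier_subset_closure)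
  refine hcpt.induction_on (p := HasGoodNormalOn Ω) ⟨by simp, by simp, by simp⟩
    (fun s t hst h => h.mono hst) (fun s t h h' => h.union h') fun x hx => ?_
  obtain ⟨L, f, K, hf, hloc⟩ := hlip x hx
  obtain ⟨r, hr, hball⟩ := Metric.eventually_nhds_iff_ball.1 hloc
  exact ⟨_, inter_mem (mem_nhdsWithin_of_mem_nhds (Metric.ball_mem_nhds x hr)) self_mem_nhdsWithin,
    hasGoodNormalOn_graph hΩ L hf Metric.isOpen_ball Metric.isBounded_ball hball⟩

theorem isFiniteMeasure_surfaceMeasure {Ω : Set E3} (hΩ : IsOpen Ω) (hb : Bornology.IsBounded Ω)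
    (hlip : HasLipschitzBoundary Ω) : IsFiniteMeasure (surfaceMeasure Ω) :=
  ⟨by simpa [surfaceMeasure] using (hasGoodNormalOn_frontier hΩ hb hlip).1⟩

/-! ### Localization -/

section Localization

variable {E : Type*} [NormedAddCommGroup E] [NormedSpace ℝ E] [FiniteDimensional ℝ E]

/-- The functions equal one on `K` and are supported on thickenings of `K` that shrink to it. A
point off the closed set `K` eventually leaves these thickenings. -/
theorem exists_contDiff_tendsto_indicator {K : Set E} (hK : IsCompact K) :
    ∃ g : ℕ → E → ℝ, (∀ n, ContDiff ℝ ((⊤ : ℕ∞) : WithTop ℕ∞) (g n)) ∧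
      (∀ n, HasCompactSupport (g n)) ∧ (∀ n x, g n x ∈ Icc (0 : ℝ) 1) ∧
      ∀ x, Tendsto (fun n => g n x) atTop (𝓝 (K.indicator 1 x)) := by
  obtain ⟨δ, δpos, hδ⟩ := hK.exists_isCompact_cthickening
  obtain ⟨u, -, u_pos, u_lim⟩ : ∃ u, StrictAnti u ∧ (∀ n : ℕ, u n ∈ Ioo 0 δ) ∧
      Tendsto u atTop (𝓝 0) := exists_seq_strictAnti_tendsto' δpos
  have hex : ∀ n, ∃ g : E → ℝ, Function.support g = Metric.thickening (u n) K ∧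
      ContDiff ℝ ((⊤ : ℕ∞) : WithTop ℕ∞) g ∧ Set.range g ⊆ Set.Icc 0 1 ∧ ∀ x ∈ K, g x = 1 := by
    intro n
    rcases exists_contMDiff_support_eq_eq_one_iff (modelWithCornersSelf ℝ E)
      Metric.isOpen_thickening hK.isClosed
      (Metric.self_subset_thickening (u_pos n).1 K) with ⟨g, g_smooth, g_range, g_supp, hg⟩
    exact ⟨g, g_supp, g_smooth.contDiff, g_range, fun x hx => (hg x).1 hx⟩
  choose g g_supp g_diff g_range hg using hex
  refine ⟨g, g_diff, fun n => ?_, fun n x => g_range n (mem_range_self x), fun x => ?_⟩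
  · refine HasCompactSupport.of_support_subset_isCompact hδ ?_
    rw [g_supp]
    exact Metric.thickening_subset_cthickening_of_le (u_pos n).2.le _
  · by_cases hx : x ∈ K
    · simp [hg _ x hx, indicator_of_mem hx]
    · rw [indicator_of_notMem hx]
      apply tendsto_const_nhds.congr'
      obtain ⟨ε, εpos, hε⟩ : ∃ ε, 0 < ε ∧ x ∉ Metric.thickening ε K := by
        rw [← hK.isClosed.closure_eq, Metric.closure_eq_iInter_thickening K] at hx
        simpa using hx
      filter_upwards [(tendsto_order.1 u_lim).2 _ εpos] with n hn
      symm
      rw [← Function.notMem_support, g_supp]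
      exact fun h => hε (Metric.thickening_mono hn.le K h)

/-- If `∫ h ψ² ≥ 0` for all smooth compactly supported `ψ`, then `h ≥ 0` almost everywhere. -/
theorem ae_nonneg_of_integral_mul_sq_nonneg [MeasurableSpace E] [BorelSpace E]
    {m : Measure E} [IsFiniteMeasure m] {h : E → ℝ}
    (hi : Integrable h m)
    (H : ∀ ψ : E → ℝ, ContDiff ℝ ((⊤ : ℕ∞) : WithTop ℕ∞) ψ → HasCompactSupport ψ →
      0 ≤ ∫ x, h x * ψ x ^ 2 ∂m) : ∀ᵐ x ∂m, 0 ≤ h x := by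
  -- Squares of cutoffs converge boundedly to the indicator of `K`, which extends the hypothesis to
  -- compact sets by dominated convergence.
  have hcomp : ∀ K : Set E, IsCompact K → 0 ≤ ∫ x in K, h x ∂m := by
    intro K hK
    obtain ⟨g, g_diff, g_supp, g_range, g_lim⟩ := exists_contDiff_tendsto_indicator hK
    have hlim : Tendsto (fun n => ∫ x, h x * g n x ^ 2 ∂m) atTop (𝓝 (∫ x in K, h x ∂m)) := by
      rw [← integral_indicator hK.measurableSet]
      refine tendsto_integral_of_dominated_convergence (fun x => ‖h x‖)
        (fun n => hi.1.mul ((g_diff n).continuous.pow 2).aestronglyMeasurable) hi.norm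
        (fun n => Eventually.of_forall fun x => ?_) (Eventually.of_forall fun x => ?_)
      · have h1 := g_range n x
        rw [norm_mul, norm_pow, Real.norm_of_nonneg h1.1]
        exact mul_le_of_le_one_right (norm_nonneg _) (pow_le_one₀ h1.1 h1.2)
      · have h2 := ((g_lim x).pow 2).const_mul (h x)
        convert h2 using 2
        by_cases hx : x ∈ K <;> simp [hx]
    exact ge_of_tendsto' hlim fun n => H _ (g_diff n) (g_supp n)
  set h' := hi.1.mk h with hh'
  have heq : h =ᵐ[m] h' := hi.1.ae_eq_mk
  have hms : MeasurableSet {x | h' x < 0} :=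
    measurableSet_lt hi.1.stronglyMeasurable_mk.measurable measurable_const
  have hnull : m {x | h' x < 0} = 0 := by
    by_contra hne
    -- Inner regularity: a negative set of positive measure would contain a compact set of positive
    -- measure, on which the integral of `h` would be negative.
    obtain ⟨K, hKs, hK, hpos⟩ := hms.exists_lt_isCompact (pos_iff_ne_zero.2 hne)
    have h0 : ∀ᵐ x ∂m.restrict K, h x < 0 := by
      filter_upwards [ae_restrict_of_ae heq, ae_restrict_mem hK.measurableSet] with x hx hxK
      rw [hx]; exact hKs hxK
    have hz : ∫ x in K, -h x ∂m = 0 := by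
      refine le_antisymm ?_ (integral_nonneg_of_ae (h0.mono fun x hx => ?_))
      · rw [integral_neg]; linarith [hcomp K hK]
      · simpa using hx.le
    have hz := (integral_eq_zero_iff_of_nonneg_ae (f := fun x => -h x)
      (h0.mono fun x hx => by simpa using hx.le) hi.neg.integrableOn).1 hz
    have : ∀ᵐ x ∂m.restrict K, False := by
      filter_upwards [hz, h0] with x h1 h2
      simp only [Pi.zero_apply, neg_eq_zero] at h1
      exact absurd h1 h2.ne
    rw [eventually_false_iff_eq_bot, ae_eq_bot, Measure.restrict_eq_zero] at this
    exact hpos.ne' this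
  filter_upwards [heq, compl_mem_ae_iff.2 hnull] with x h1 h2
  rw [h1]; exact not_lt.1 h2

end Localization

/-! ### Smooth fields as elements of `H⁺(curl, Ω)` -/

theorem IsSmoothField.continuous {v : E3 → C3} (hv : IsSmoothField v) : Continuous v :=
  hv.1.continuous

theorem contDiff_partialDeriv {v : E3 → C3} (hv : IsSmoothField v) (j i : Fin 3) :
    ContDiff ℝ ((⊤ : ℕ∞) : WithTop ℕ∞) (partialDeriv v j i) := by
  have h1 : ContDiff ℝ ((⊤ : ℕ∞) : WithTop ℕ∞) (fderiv ℝ v) := hv.1.fderiv_right (by simp)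
  have h2 : ContDiff ℝ ((⊤ : ℕ∞) : WithTop ℕ∞)
      fun x => fderiv ℝ v x (EuclideanSpace.single j 1) := h1.clm_apply contDiff_const
  exact (contDiff_piLp 2).1 h2 i

theorem IsSmoothField.curl {v : E3 → C3} (hv : IsSmoothField v) : IsSmoothField (curl v) := by
  constructor
  · refine (contDiff_piLp 2).2 fun i => ?_
    fin_cases i <;>
      exact (contDiff_partialDeriv hv _ _).sub (contDiff_partialDeriv hv _ _)
  · refine (hv.2.fderiv ℝ).mono fun x hx => ?_
    rw [Function.mem_support] at hx ⊢
    contrapose! hx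
    ext i
    fin_cases i <;> simp [Maxwell.curl, partialDeriv, hx]

theorem IsSmoothField.memLp {v : E3 → C3} (hv : IsSmoothField v) (m : Measure E3)
    [IsFiniteMeasure m] : MemLp v 2 m :=
  hv.continuous.memLp_of_hasCompactSupport hv.2

theorem IsSmoothField.hasFDerivAt_coord {v : E3 → C3} (hv : IsSmoothField v) (i : Fin 3) (x : E3) :
    HasFDerivAt (fun y => v y i)
      (((EuclideanSpace.proj i : C3 →L[ℂ] ℂ).restrictScalars ℝ).comp (fderiv ℝ v x)) x :=
  ((EuclideanSpace.proj i : C3 →L[ℂ] ℂ).restrictScalars ℝ).hasFDerivAt.comp x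
    (hv.1.differentiable (by simp) x).hasFDerivAt

theorem fderiv_coord {v : E3 → C3} (hv : IsSmoothField v) (j i : Fin 3) (x : E3) :
    fderiv ℝ (fun y => v y i) x (EuclideanSpace.single j 1) = partialDeriv v j i x := by
  rw [(hv.hasFDerivAt_coord i x).fderiv]
  rfl

theorem hasFDerivAt_conj_coord {v : E3 → C3} (hv : IsSmoothField v) (i : Fin 3) (x : E3) :
    HasFDerivAt (fun y => (starRingEnd ℂ) (v y i))
      ((Complex.conjCLE : ℂ →L[ℝ] ℂ).comp (fderiv ℝ (fun y => v y i) x)) x := by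
  rw [(hv.hasFDerivAt_coord i x).fderiv]
  exact (Complex.conjCLE : ℂ →L[ℝ] ℂ).hasFDerivAt.comp x (hv.hasFDerivAt_coord i x)

theorem IsSmoothField.coord_integrable_of_continuous {v : E3 → C3} (hv : IsSmoothField v)
    {w : E3 → ℂ} (hw : Continuous w) (i : Fin 3) :
    Integrable fun x => (starRingEnd ℂ) (v x i) * w x := by
  have hv' := hv.continuous
  refine Continuous.integrable_of_hasCompactSupport (by fun_prop) (hv.2.mono fun x hx => ?_)
  rw [Function.mem_support] at hx ⊢
  contrapose! hx
  simp [hx]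

theorem integral_conj_partialDeriv_mul {φ v : E3 → C3} (hφ : IsSmoothField φ)
    (hv : IsSmoothField v) (j i k : Fin 3) :
    ∫ x, (starRingEnd ℂ) (partialDeriv φ j i x) * v x k
      = -∫ x, (starRingEnd ℂ) (φ x i) * partialDeriv v j k x := by
  have hφ' := hφ.continuous
  have hv' := hv.continuous
  have hd : ∀ x, fderiv ℝ (fun y => (starRingEnd ℂ) (φ y i)) x (EuclideanSpace.single j 1)
      = (starRingEnd ℂ) (partialDeriv φ j i x) := fun x => by
    rw [(hasFDerivAt_conj_coord hφ i x).fderiv, ← fderiv_coord hφ]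
    rfl
  have hp : Continuous (partialDeriv φ j i) := (contDiff_partialDeriv hφ j i).continuous
  have h := integral_mul_fderiv_eq_neg_fderiv_mul_of_integrable (μ := (volume : Measure E3))
    (f := fun x => (starRingEnd ℂ) (φ x i)) (g := fun x => v x k)
    (v := EuclideanSpace.single j 1) ?_ ?_ ?_
    (fun x _ => (hasFDerivAt_conj_coord hφ i x).differentiableAt)
    (fun x _ => (hv.hasFDerivAt_coord k x).differentiableAt)
  · simp only [hd, fderiv_coord hv] at h
    rw [h, neg_neg]
  · simp only [hd]
    refine Continuous.integrable_of_hasCompactSupport (by fun_prop) (hv.2.mono fun x hx => ?_)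
    rw [Function.mem_support] at hx ⊢
    contrapose! hx
    simp [hx]
  · simp only [fderiv_coord hv]
    exact hφ.coord_integrable_of_continuous (contDiff_partialDeriv hv j k).continuous i
  · exact hφ.coord_integrable_of_continuous (by fun_prop) i

theorem integral_sub_add_sub_add_sub {a b c d e f : E3 → ℂ} (ha : Integrable a) (hb : Integrable b)
    (hc : Integrable c) (hd : Integrable d) (he : Integrable e) (hf : Integrable f) :
    ∫ x, ((a x - b x) + (c x - d x) + (e x - f x)) =
      ((∫ x, a x) - ∫ x, b x) + ((∫ x, c x) - ∫ x, d x) + ((∫ x, e x) - ∫ x, f x) := by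
  rw [integral_add (f := fun x => (a x - b x) + (c x - d x)) (g := fun x => e x - f x)
      ((ha.sub hb).add (hc.sub hd)) (he.sub hf),
    integral_add (f := fun x => a x - b x) (g := fun x => c x - d x) (ha.sub hb) (hc.sub hd),
    integral_sub ha hb, integral_sub hc hd, integral_sub he hf]

/-- Compact support removes the boundary terms in the integrations by parts, and their sign change
is cancelled by the antisymmetry of the curl. -/
theorem integral_inner_curl {φ v : E3 → C3} (hφ : IsSmoothField φ) (hv : IsSmoothField v) :
    ∫ x, inner ℂ (curl φ x) (v x) = ∫ x, inner ℂ (φ x) (curl v x) := by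
  have hv' := hv.continuous
  have hA : ∀ j i k : Fin 3,
      Integrable fun x => (starRingEnd ℂ) (partialDeriv φ j i x) * v x k := fun j i k => by
    have hp : Continuous (partialDeriv φ j i) := (contDiff_partialDeriv hφ j i).continuous
    refine Continuous.integrable_of_hasCompactSupport (by fun_prop) (hv.2.mono fun x hx => ?_)
    rw [Function.mem_support] at hx ⊢
    contrapose! hx
    simp [hx]
  have hB : ∀ j i k : Fin 3,
      Integrable fun x => (starRingEnd ℂ) (φ x i) * partialDeriv v j k x := fun j i k =>
    hφ.coord_integrable_of_continuous (contDiff_partialDeriv hv j k).continuous i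
  have e1 : ∀ x, inner ℂ (curl φ x) (v x) =
      ((starRingEnd ℂ) (partialDeriv φ 1 2 x) * v x 0
        - (starRingEnd ℂ) (partialDeriv φ 2 1 x) * v x 0)
      + ((starRingEnd ℂ) (partialDeriv φ 2 0 x) * v x 1
        - (starRingEnd ℂ) (partialDeriv φ 0 2 x) * v x 1)
      + ((starRingEnd ℂ) (partialDeriv φ 0 1 x) * v x 2
        - (starRingEnd ℂ) (partialDeriv φ 1 0 x) * v x 2) := fun x => by
    simp [PiLp.inner_apply, Fin.sum_univ_three, curl]
    ring
  have e2 : ∀ x, inner ℂ (φ x) (curl v x) =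
      ((starRingEnd ℂ) (φ x 0) * partialDeriv v 1 2 x
        - (starRingEnd ℂ) (φ x 0) * partialDeriv v 2 1 x)
      + ((starRingEnd ℂ) (φ x 1) * partialDeriv v 2 0 x
        - (starRingEnd ℂ) (φ x 1) * partialDeriv v 0 2 x)
      + ((starRingEnd ℂ) (φ x 2) * partialDeriv v 0 1 x
        - (starRingEnd ℂ) (φ x 2) * partialDeriv v 1 0 x) := fun x => by
    simp [PiLp.inner_apply, Fin.sum_univ_three, curl]
    ring
  simp_rw [e1, e2]
  rw [integral_sub_add_sub_add_sub (hA _ _ _) (hA _ _ _) (hA _ _ _) (hA _ _ _) (hA _ _ _)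
      (hA _ _ _), integral_sub_add_sub_add_sub (hB _ _ _) (hB _ _ _) (hB _ _ _) (hB _ _ _)
      (hB _ _ _) (hB _ _ _)]
  simp only [integral_conj_partialDeriv_mul hφ hv]
  ring

theorem isWeakCurl_of_smooth {Ω : Set E3} {v : E3 → C3} (hv : IsSmoothField v)
    {u w : L2Vol Ω} (hu : u =ᵐ[volume.restrict Ω] v) (hw : w =ᵐ[volume.restrict Ω] curl v) :
    IsWeakCurl Ω u w := by
  intro φ hφ hsupp Φ Ψ hΦ hΨ
  rw [L2.inner_def, L2.inner_def]
  have e1 : ∫ x in Ω, inner ℂ (Ψ x) (u x) = ∫ x in Ω, inner ℂ (curl φ x) (v x) :=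
    integral_congr_ae (by filter_upwards [hΨ, hu] with x h1 h2; rw [h1, h2])
  have e2 : ∫ x in Ω, inner ℂ (Φ x) (w x) = ∫ x in Ω, inner ℂ (φ x) (curl v x) :=
    integral_congr_ae (by filter_upwards [hΦ, hw] with x h1 h2; rw [h1, h2])
  -- A test field supported in `Ω` vanishes outside it together with its curl, so the integrals
  -- extend to the whole space.
  have hz : ∀ x, x ∉ Ω → φ x = 0 := fun x hx => image_eq_zero_of_notMem_tsupport fun h => hx (hsupp h)
  have hz' : ∀ x, x ∉ Ω → curl φ x = 0 := fun x hx => by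
    have : fderiv ℝ φ x = 0 := fderiv_of_notMem_tsupport ℝ fun h => hx (hsupp h)
    ext i
    fin_cases i <;> simp [curl, partialDeriv, this]
  rw [e1, e2, setIntegral_eq_integral_of_forall_compl_eq_zero fun x hx => by simp [hz' x hx],
    setIntegral_eq_integral_of_forall_compl_eq_zero fun x hx => by simp [hz x hx],
    integral_inner_curl hφ hv]

/-- Lagrange's identity; it remains valid for complex `z` because `n` is real. -/
theorem norm_crossReal_sq (z : C3) (n : E3) :
    ‖crossReal z n‖ ^ 2 = ‖z‖ ^ 2 * ‖n‖ ^ 2 - ‖∑ i, z i * (n i : ℂ)‖ ^ 2 := by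
  simp only [EuclideanSpace.norm_sq_eq, Fin.sum_univ_three, crossReal, Complex.sq_norm,
    Complex.normSq_apply]
  simp
  ring

theorem norm_crossReal_le (z : C3) (n : E3) : ‖crossReal z n‖ ≤ ‖z‖ * ‖n‖ := by
  refine le_of_sq_le_sq ?_ (by positivity)
  rw [norm_crossReal_sq, mul_pow]
  linarith [sq_nonneg ‖∑ i, z i * (n i : ℂ)‖]

theorem continuous_crossReal : Continuous fun p : C3 × E3 => crossReal p.1 p.2 := by
  unfold crossReal
  apply (PiLp.continuous_toLp 2 _).comp
  refine continuous_pi fun i => ?_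
  fin_cases i <;> simp <;> fun_prop

theorem aestronglyMeasurable_crossReal {m : Measure E3} {v : E3 → C3} (hv : Continuous v)
    {n : E3 → E3} (hn : AEStronglyMeasurable n m) :
    AEStronglyMeasurable (fun x => crossReal (v x) (n x)) m := by
  have h : AEStronglyMeasurable (fun x => (v x, n x)) m := hv.aestronglyMeasurable.prodMk hn
  exact Continuous.comp_aestronglyMeasurable (g := fun p : C3 × E3 => crossReal p.1 p.2)
    (f := fun x => (v x, n x)) continuous_crossReal h

/-- A field that is smooth up to the boundary belongs to `H⁺(curl, Ω)`. -/
theorem exists_HPlusCurl_of_smooth {Ω : Set E3} [IsFiniteMeasure (volume.restrict Ω)]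
    [IsFiniteMeasure (surfaceMeasure Ω)]
    (hn : AEStronglyMeasurable (outwardNormal Ω) (surfaceMeasure Ω))
    {v : E3 → C3} (hv : IsSmoothField v) :
    ∃ u : HPlusCurl Ω, fieldOf u =ᵐ[volume.restrict Ω] v ∧
      curlOf u =ᵐ[volume.restrict Ω] curl v ∧
      traceOf u =ᵐ[surfaceMeasure Ω] fun x => crossReal (v x) (outwardNormal Ω x) := by
  have hA := hv.memLp (volume.restrict Ω)
  have hB := hv.curl.memLp (volume.restrict Ω)
  have hG : MemLp (fun x => crossReal (v x) (outwardNormal Ω x)) 2 (surfaceMeasure Ω) := by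
    refine (hv.memLp (surfaceMeasure Ω)).mono (aestronglyMeasurable_crossReal hv.continuous hn) (Eventually.of_forall fun x => ?_)
    exact (norm_crossReal_le _ _).trans
      (mul_le_of_le_one_right (norm_nonneg _) (norm_outwardNormal_le Ω x))
  have hT : IsSmoothTriple Ω (hA.toLp v) (hB.toLp (curl v)) (hG.toLp _) :=
    ⟨v, hv, hA.coeFn_toLp, hB.coeFn_toLp, hG.coeFn_toLp⟩
  refine ⟨⟨WithLp.toLp 2 (hA.toLp v, WithLp.toLp 2 (hB.toLp (curl v), hG.toLp _)), ?_, ?_, ?_⟩,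
    hA.coeFn_toLp, hB.coeFn_toLp, hG.coeFn_toLp⟩
  · exact isWeakCurl_of_smooth hv hA.coeFn_toLp hB.coeFn_toLp
  -- A smooth field is its own approximation: constant sequences define the trace.
  · exact ⟨fun _ => _, fun _ => _, fun _ => _, fun _ => hT, tendsto_const_nhds, tendsto_const_nhds,
      fun _ _ _ _ => tendsto_const_nhds⟩
  · filter_upwards [hG.coeFn_toLp] with x hx
    change ∑ i, (hG.toLp _ : L2Sur Ω) x i * (outwardNormal Ω x i : ℂ) = 0
    rw [hx]
    simp [Fin.sum_univ_three, crossReal]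
    ring

/-! ### Oscillating gradients -/

/-- The gradient of a complex scalar field. -/
def gradField (p : E3 → ℂ) (x : E3) : C3 :=
  WithLp.toLp 2 fun j => fderiv ℝ p x (EuclideanSpace.single j 1)

theorem isSmoothField_gradField {p : E3 → ℂ} (hp : ContDiff ℝ ((⊤ : ℕ∞) : WithTop ℕ∞) p)
    (hc : HasCompactSupport p) : IsSmoothField (gradField p) := by
  constructor
  · refine (contDiff_piLp 2).2 fun i => ?_
    exact (hp.fderiv_right (by simp)).clm_apply contDiff_const
  · refine (hc.fderiv ℝ).mono fun x hx => ?_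
    rw [Function.mem_support] at hx ⊢
    contrapose! hx
    ext i
    simp [gradField, hx]

/-- Symmetry of the second derivative. -/
theorem curl_gradField {p : E3 → ℂ} (hp : ContDiff ℝ ((⊤ : ℕ∞) : WithTop ℕ∞) p)
    (hc : HasCompactSupport p) (x : E3) : curl (gradField p) x = 0 := by
  have hsm : IsSymmSndFDerivAt ℝ p x :=
    (hp.contDiffAt).isSymmSndFDerivAt (by
      rw [minSmoothness_of_isRCLikeNormedField]
      exact WithTop.coe_le_coe.2 (le_top : (2 : ℕ∞) ≤ ⊤))
  have hd : DifferentiableAt ℝ (fderiv ℝ p) x :=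
    ((hp.fderiv_right (m := ((⊤ : ℕ∞) : WithTop ℕ∞)) (by simp)).differentiable (by simp)) x
  have hpd : ∀ j i, partialDeriv (gradField p) j i x =
      fderiv ℝ (fderiv ℝ p) x (EuclideanSpace.single j 1) (EuclideanSpace.single i 1) := by
    intro j i
    rw [← fderiv_coord (isSmoothField_gradField hp hc)]
    simp only [gradField]
    rw [fderiv_clm_apply hd (by fun_prop)]
    simp
  ext i
  fin_cases i <;> simp [curl, hpd, sub_eq_zero] <;> exact hsm.eq _ _

/-- The phase factor `exp (i N x_k)`. -/
def planeWave (N : ℝ) (k : Fin 3) (x : E3) : ℂ := Complex.exp (Complex.I * ((N * x k : ℝ) : ℂ))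

theorem norm_planeWave (N : ℝ) (k : Fin 3) (x : E3) : ‖planeWave N k x‖ = 1 := by
  rw [planeWave, mul_comm, Complex.norm_exp_ofReal_mul_I]

theorem contDiff_planeWave (N : ℝ) (k : Fin 3) :
    ContDiff ℝ ((⊤ : ℕ∞) : WithTop ℕ∞) (planeWave N k) := by
  have h : ContDiff ℝ ((⊤ : ℕ∞) : WithTop ℕ∞) fun x : E3 => N * x k :=
    contDiff_const.mul ((contDiff_piLp 2).1 contDiff_id k)
  exact (contDiff_const.mul (Complex.ofRealCLM.contDiff.comp h)).cexp

theorem contDiff_ofReal_comp {ψ : E3 → ℝ} (hψ : ContDiff ℝ ((⊤ : ℕ∞) : WithTop ℕ∞) ψ) :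
    ContDiff ℝ ((⊤ : ℕ∞) : WithTop ℕ∞) fun x => (ψ x : ℂ) :=
  Complex.ofRealCLM.contDiff.comp hψ

theorem hasCompactSupport_ofReal_comp {ψ : E3 → ℝ} (hc : HasCompactSupport ψ) :
    HasCompactSupport fun x => (ψ x : ℂ) :=
  hc.comp_left (g := fun t : ℝ => (t : ℂ)) (by simp)

theorem fderiv_ofReal_comp {ψ : E3 → ℝ} (hψ : ContDiff ℝ ((⊤ : ℕ∞) : WithTop ℕ∞) ψ) (x y : E3) :
    fderiv ℝ (fun x => (ψ x : ℂ)) x y = (fderiv ℝ ψ x y : ℂ) := by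
  have h := Complex.ofRealCLM.hasFDerivAt.comp x
    (hψ.differentiable (by simp) x).hasFDerivAt
  exact congrArg (fun T => T y) h.fderiv

theorem fderiv_mul_planeWave {ψ : E3 → ℝ} (hψ : ContDiff ℝ ((⊤ : ℕ∞) : WithTop ℕ∞) ψ)
    (N : ℝ) (k j : Fin 3) (x : E3) :
    fderiv ℝ (fun x => (ψ x : ℂ) * planeWave N k x) x (EuclideanSpace.single j 1) =
      planeWave N k x * ((fderiv ℝ ψ x (EuclideanSpace.single j 1) : ℂ)
        + Complex.I * ((N * ψ x * (if k = j then 1 else 0) : ℝ) : ℂ)) := by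
  have h1 : HasFDerivAt (fun x : E3 => N * x k)
      (N • (EuclideanSpace.proj k : E3 →L[ℝ] ℝ)) x :=
    (EuclideanSpace.proj k : E3 →L[ℝ] ℝ).hasFDerivAt.const_mul N
  have h2 : HasFDerivAt (planeWave N k) _ x :=
    ((Complex.ofRealCLM.hasFDerivAt.comp x h1).const_mul Complex.I).cexp
  have h3 : HasFDerivAt (fun x => (ψ x : ℂ) * planeWave N k x) _ x :=
    ((contDiff_ofReal_comp hψ).differentiable (by simp) x).hasFDerivAt.mul h2
  rw [h3.fderiv]
  have hpw : Complex.exp (Complex.I * (Complex.ofRealCLM ∘ fun x : E3 => N * x k) x)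
      = planeWave N k x := rfl
  rw [hpw]
  by_cases hkj : k = j
  · simp [fderiv_ofReal_comp hψ, hkj]
    ring
  · simp [fderiv_ofReal_comp hψ, hkj]

/-- The field `∇(ψ exp(i N x_k)) / N`. -/
def waveField (ψ : E3 → ℝ) (N : ℝ) (k : Fin 3) : E3 → C3 :=
  gradField fun x => ((N⁻¹ * ψ x : ℝ) : ℂ) * planeWave N k x

section WaveField

variable {ψ : E3 → ℝ}

theorem isSmoothField_waveField (hψ : ContDiff ℝ ((⊤ : ℕ∞) : WithTop ℕ∞) ψ)
    (hc : HasCompactSupport ψ) (N : ℝ) (k : Fin 3) : IsSmoothField (waveField ψ N k) :=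
  isSmoothField_gradField ((contDiff_ofReal_comp (contDiff_const.mul hψ)).mul
    (contDiff_planeWave N k)) ((hasCompactSupport_ofReal_comp (hc.mul_left)).mul_right)

theorem curl_waveField (hψ : ContDiff ℝ ((⊤ : ℕ∞) : WithTop ℕ∞) ψ)
    (hc : HasCompactSupport ψ) (N : ℝ) (k : Fin 3) (x : E3) : curl (waveField ψ N k) x = 0 :=
  curl_gradField ((contDiff_ofReal_comp (contDiff_const.mul hψ)).mul
    (contDiff_planeWave N k)) ((hasCompactSupport_ofReal_comp (hc.mul_left)).mul_right) x

/-- Dividing by `N` leaves a leading term `i ψ e_k` of size independent of `N`; the derivative of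
the cutoff contributes only at order `1/N`. -/
theorem waveField_apply (hψ : ContDiff ℝ ((⊤ : ℕ∞) : WithTop ℕ∞) ψ)
    {N : ℝ} (hN : N ≠ 0) (k : Fin 3) (x : E3) (j : Fin 3) :
    waveField ψ N k x j = planeWave N k x *
      (((N⁻¹ * fderiv ℝ ψ x (EuclideanSpace.single j 1) : ℝ) : ℂ)
        + Complex.I * ((ψ x * (if k = j then 1 else 0) : ℝ) : ℂ)) := by
  have h := fderiv_mul_planeWave (ψ := fun x => N⁻¹ * ψ x) (contDiff_const.mul hψ) N k j x
  rw [fderiv_const_mul (hψ.differentiable (by simp) x)] at h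
  simp only [waveField, gradField]
  rw [h]
  simp [mul_inv_cancel_left₀ hN]

/-- After removal of the unimodular phase the leading term is imaginary and the remainder real.
Hence there is no cross term, and the formula is exact rather than asymptotic. -/
theorem norm_waveField_sq (hψ : ContDiff ℝ ((⊤ : ℕ∞) : WithTop ℕ∞) ψ)
    {N : ℝ} (hN : N ≠ 0) (k : Fin 3) (x : E3) :
    ‖waveField ψ N k x‖ ^ 2 = ψ x ^ 2 + (N ^ 2)⁻¹ * ‖gradField (fun x => (ψ x : ℂ)) x‖ ^ 2 := by
  simp only [EuclideanSpace.norm_sq_eq, waveField_apply hψ hN, norm_mul, norm_planeWave, one_mul,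
    Complex.sq_norm, Complex.normSq_apply, gradField, fderiv_ofReal_comp hψ, Fin.sum_univ_three]
  fin_cases k <;> simp <;> ring

theorem norm_crossReal_waveField_sq (hψ : ContDiff ℝ ((⊤ : ℕ∞) : WithTop ℕ∞) ψ)
    {N : ℝ} (hN : N ≠ 0) (k : Fin 3) (x n : E3) :
    ‖crossReal (waveField ψ N k x) n‖ ^ 2 = ψ x ^ 2 * (‖n‖ ^ 2 - n k ^ 2)
      + (N ^ 2)⁻¹ * ‖crossReal (gradField (fun x => (ψ x : ℂ)) x) n‖ ^ 2 := by
  have h1 : ∑ i, waveField ψ N k x i * (n i : ℂ) = planeWave N k x *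
      (((N⁻¹ * ∑ i, fderiv ℝ ψ x (EuclideanSpace.single i 1) * n i : ℝ) : ℂ)
        + Complex.I * ((ψ x * n k : ℝ) : ℂ)) := by
    simp only [waveField_apply hψ hN, Fin.sum_univ_three]
    fin_cases k <;> simp <;> ring
  have h2 : ∑ i, gradField (fun x => (ψ x : ℂ)) x i * (n i : ℂ)
      = ((∑ i, fderiv ℝ ψ x (EuclideanSpace.single i 1) * n i : ℝ) : ℂ) := by
    simp [gradField, fderiv_ofReal_comp hψ]
  rw [norm_crossReal_sq, norm_crossReal_sq, norm_waveField_sq hψ hN, h1, h2, norm_mul,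
    norm_planeWave, one_mul]
  simp only [Complex.sq_norm, Complex.normSq_apply]
  simp
  ring

end WaveField

theorem IsSmoothField.exists_bound {v : E3 → C3} (hv : IsSmoothField v) : ∃ M, ∀ x, ‖v x‖ ≤ M :=
  hv.2.exists_bound_of_continuous hv.continuous

theorem integrable_mul_of_bound {m : Measure E3} {f g : E3 → ℝ} (hf : Integrable f m)
    (hg : AEStronglyMeasurable g m) {M : ℝ} (hM : ∀ x, |g x| ≤ M) :
    Integrable (fun x => f x * g x) m := by
  simpa only [mul_comm] using
    hf.bdd_mul (c := M) hg (Eventually.of_forall fun x => by simpa using hM x)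

theorem nonneg_of_forall_add_inv_sq_mul {A B : ℝ}
    (h : ∀ n : ℕ, 0 < n → 0 ≤ A + ((n : ℝ) ^ 2)⁻¹ * B) : 0 ≤ A := by
  have hl : Tendsto (fun n : ℕ => A + ((n : ℝ) ^ 2)⁻¹ * B) atTop (𝓝 (A + 0 * B)) := by
    refine (Tendsto.mul_const B ?_).const_add A
    exact tendsto_inv_atTop_zero.comp
      ((tendsto_pow_atTop two_ne_zero).comp tendsto_natCast_atTop_atTop)
  rw [zero_mul, add_zero] at hl
  exact ge_of_tendsto hl ((eventually_gt_atTop 0).mono h)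

/-- A quadratic functional with integrable weights that is nonnegative on all smooth curl free
fields has nonnegative weights. -/
theorem ae_nonneg_of_curl_free {Ω : Set E3} (hΩ : IsOpen Ω) [IsFiniteMeasure (volume.restrict Ω)]
    [IsFiniteMeasure (surfaceMeasure Ω)]
    (hn : AEStronglyMeasurable (outwardNormal Ω) (surfaceMeasure Ω))
    (hn1 : ∀ᵐ x ∂surfaceMeasure Ω, ‖outwardNormal Ω x‖ = 1) {f g : E3 → ℝ}
    (hf : Integrable f (volume.restrict Ω)) (hg : Integrable g (surfaceMeasure Ω))
    (H : ∀ v, IsSmoothField v → (∀ x, curl v x = 0) →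
      0 ≤ (∫ x in Ω, f x * ‖v x‖ ^ 2) +
        ∫ x, g x * ‖crossReal (v x) (outwardNormal Ω x)‖ ^ 2 ∂surfaceMeasure Ω) :
    (∀ᵐ x ∂volume.restrict Ω, 0 ≤ f x) ∧ ∀ᵐ x ∂surfaceMeasure Ω, 0 ≤ g x := by
  -- The factors 3 and 2 arise by summing over the axes: `∑ₖ 1 = 3` in the volume and `∑ₖ (|n|² -
  -- n_k²) = 3 - 1 = 2` on the boundary.
  have key : ∀ ψ : E3 → ℝ, ContDiff ℝ ((⊤ : ℕ∞) : WithTop ℕ∞) ψ → HasCompactSupport ψ →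
      0 ≤ (∫ x in Ω, 3 * f x * ψ x ^ 2) + ∫ x, 2 * g x * ψ x ^ 2 ∂surfaceMeasure Ω := by
    intro ψ hψ hc
    have hw : IsSmoothField (gradField fun x => (ψ x : ℂ)) :=
      isSmoothField_gradField (contDiff_ofReal_comp hψ) (hasCompactSupport_ofReal_comp hc)
    obtain ⟨M, hM⟩ := hc.exists_bound_of_continuous hψ.continuous
    obtain ⟨M', hM'⟩ := hw.exists_bound
    have hψm : ∀ m : Measure E3, AEStronglyMeasurable (fun x => ψ x ^ 2) m := fun m =>
      (hψ.continuous.pow 2).aestronglyMeasurable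
    have hψb : ∀ x, ψ x ^ 2 ≤ M ^ 2 := fun x => by
      have h := hM x
      rw [← sq_abs]
      exact pow_le_pow_left₀ (abs_nonneg _) h 2
    have hnk : ∀ k, AEStronglyMeasurable (fun x => outwardNormal Ω x k) (surfaceMeasure Ω) :=
      fun k => (EuclideanSpace.proj k : E3 →L[ℝ] ℝ).continuous.comp_aestronglyMeasurable hn
    have hnk1 : ∀ k x, outwardNormal Ω x k ^ 2 ≤ ‖outwardNormal Ω x‖ ^ 2 := fun k x => by
      rw [EuclideanSpace.real_norm_sq_eq]
      exact Finset.single_le_sum (f := fun i => outwardNormal Ω x i ^ 2)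
        (fun i _ => sq_nonneg _) (Finset.mem_univ k)
    have hn2 : ∀ x, ‖outwardNormal Ω x‖ ^ 2 ≤ 1 := fun x =>
      pow_le_one₀ (norm_nonneg _) (norm_outwardNormal_le Ω x)
    have i1 : Integrable (fun x => f x * ψ x ^ 2) (volume.restrict Ω) :=
      integrable_mul_of_bound hf (hψm _) (M := M ^ 2) fun x => by
        rw [abs_of_nonneg (sq_nonneg _)]; exact hψb x
    have i2 : Integrable (fun x => f x * ‖gradField (fun x => (ψ x : ℂ)) x‖ ^ 2)
        (volume.restrict Ω) :=
      integrable_mul_of_bound hf (hw.continuous.norm.pow 2).aestronglyMeasurable (M := M' ^ 2)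
        fun x => by
          rw [abs_of_nonneg (sq_nonneg _)]
          exact pow_le_pow_left₀ (norm_nonneg _) (hM' x) 2
    have i3 : ∀ k, Integrable (fun x => g x *
        (ψ x ^ 2 * (‖outwardNormal Ω x‖ ^ 2 - outwardNormal Ω x k ^ 2))) (surfaceMeasure Ω) :=
      fun k => integrable_mul_of_bound hg
        ((hψm _).mul ((hn.norm.pow 2).sub ((hnk k).pow 2))) (M := M ^ 2) fun x => by
          have h1 := hnk1 k x
          have h2 := hn2 x
          have h3 := sq_nonneg (outwardNormal Ω x k)
          rw [abs_of_nonneg (mul_nonneg (sq_nonneg _) (by linarith))]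
          exact (mul_le_of_le_one_right (sq_nonneg _) (by linarith)).trans (hψb x)
    have i4 : Integrable (fun x => g x *
        ‖crossReal (gradField (fun x => (ψ x : ℂ)) x) (outwardNormal Ω x)‖ ^ 2)
        (surfaceMeasure Ω) :=
      integrable_mul_of_bound hg
        ((aestronglyMeasurable_crossReal hw.continuous hn).norm.pow 2) (M := M' ^ 2) fun x => by
          rw [abs_of_nonneg (sq_nonneg _)]
          refine pow_le_pow_left₀ (norm_nonneg _) ((norm_crossReal_le _ _).trans ?_) 2
          exact (mul_le_of_le_one_right (norm_nonneg _) (norm_outwardNormal_le Ω x)).trans (hM' x)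
    have hk : ∀ k, 0 ≤ (∫ x in Ω, f x * ψ x ^ 2) + ∫ x, g x *
        (ψ x ^ 2 * (‖outwardNormal Ω x‖ ^ 2 - outwardNormal Ω x k ^ 2)) ∂surfaceMeasure Ω := by
      intro k
      -- The remainder `B` does not depend on `N`, so it disappears as `N → ∞`.
      refine nonneg_of_forall_add_inv_sq_mul
        (B := (∫ x in Ω, f x * ‖gradField (fun x => (ψ x : ℂ)) x‖ ^ 2) + ∫ x, g x *
          ‖crossReal (gradField (fun x => (ψ x : ℂ)) x) (outwardNormal Ω x)‖ ^ 2
            ∂surfaceMeasure Ω) fun N hN => ?_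
      have hN0 : (N : ℝ) ≠ 0 := by positivity
      have h := H _ (isSmoothField_waveField hψ hc N k) (curl_waveField hψ hc N k)
      simp only [norm_waveField_sq hψ hN0, norm_crossReal_waveField_sq hψ hN0, mul_add,
        mul_left_comm _ (((N : ℝ) ^ 2)⁻¹) _] at h
      rw [integral_add i1 (i2.const_mul _), integral_add (i3 k) (i4.const_mul _),
        integral_const_mul, integral_const_mul] at h
      linarith
    have hsum : ∫ x, 2 * g x * ψ x ^ 2 ∂surfaceMeasure Ω = ∑ k, ∫ x, g x *
        (ψ x ^ 2 * (‖outwardNormal Ω x‖ ^ 2 - outwardNormal Ω x k ^ 2)) ∂surfaceMeasure Ω := by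
      rw [← integral_finsetSum _ fun k _ => i3 k]
      refine integral_congr_ae (hn1.mono fun x hx => ?_)
      have h1 : ∑ k, outwardNormal Ω x k ^ 2 = 1 := by
        rw [← EuclideanSpace.real_norm_sq_eq, hx, one_pow]
      simp only [hx, Fin.sum_univ_three] at h1 ⊢
      linear_combination (g x * ψ x ^ 2) * h1
    have hvol : ∫ x in Ω, 3 * f x * ψ x ^ 2 = 3 * ∫ x in Ω, f x * ψ x ^ 2 := by
      rw [← integral_const_mul]
      simp only [mul_assoc]
    rw [hsum, hvol, Fin.sum_univ_three]
    linarith [hk 0, hk 1, hk 2]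
  have hΩm : MeasurableSet Ω := hΩ.measurableSet
  have hsΩ : ∀ᵐ x ∂surfaceMeasure Ω, x ∉ Ω := by
    filter_upwards [ae_restrict_mem isClosed_frontier.measurableSet] with x hx
    rw [hΩ.frontier_eq] at hx
    exact hx.2
  classical
  -- The open set `Ω` does not meet its boundary, so one function carries both weights and can be
  -- tested against the sum of the two measures.
  set h : E3 → ℝ := fun x => if x ∈ Ω then 3 * f x else 2 * g x with hh
  have e1 : h =ᵐ[volume.restrict Ω] fun x => 3 * f x := by
    filter_upwards [ae_restrict_mem hΩm] with x hx using by simp [hh, hx]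
  have e2 : h =ᵐ[surfaceMeasure Ω] fun x => 2 * g x := by
    filter_upwards [hsΩ] with x hx using by simp [hh, hx]
  have hi1 : Integrable h (volume.restrict Ω) := (hf.const_mul 3).congr e1.symm
  have hi2 : Integrable h (surfaceMeasure Ω) := (hg.const_mul 2).congr e2.symm
  have hpos := ae_nonneg_of_integral_mul_sq_nonneg (hi1.add_measure hi2) fun ψ hψ hc => by
    obtain ⟨M, hM⟩ := hc.exists_bound_of_continuous hψ.continuous
    have hb : ∀ x, |ψ x ^ 2| ≤ M ^ 2 := fun x => by
      rw [abs_pow]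
      exact pow_le_pow_left₀ (abs_nonneg _) (hM x) 2
    have hm : ∀ m : Measure E3, AEStronglyMeasurable (fun x => ψ x ^ 2) m := fun m =>
      (hψ.continuous.pow 2).aestronglyMeasurable
    rw [integral_add_measure (integrable_mul_of_bound hi1 (hm _) hb)
      (integrable_mul_of_bound hi2 (hm _) hb)]
    convert key ψ hψ hc using 2
    · exact integral_congr_ae (e1.mono fun x hx => by simp only [hx])
    · exact integral_congr_ae (e2.mono fun x hx => by simp only [hx])
  rw [ae_add_measure_iff] at hpos
  constructor
  · filter_upwards [hpos.1, e1] with x h1 h2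
    rw [h2] at h1; linarith
  · filter_upwards [hpos.2, e2] with x h1 h2
    rw [h2] at h1; linarith

/-! ### The real part of the rotated Robin form -/

theorem integrable_norm_sq {m : Measure E3} (g : Lp C3 2 m) : Integrable (fun x => ‖g x‖ ^ 2) m :=
  (memLp_two_iff_integrable_sq_norm (Lp.aestronglyMeasurable g)).1 (Lp.memLp g)

theorem integral_norm_sq {m : Measure E3} (g : Lp C3 2 m) : ∫ x, ‖g x‖ ^ 2 ∂m = ‖g‖ ^ 2 := by
  have h : inner ℂ g g = ((∫ x, ‖g x‖ ^ 2 ∂m : ℝ) : ℂ) := by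
    rw [L2.inner_def, ← integral_complex_ofReal]
    refine integral_congr_ae (Eventually.of_forall fun x => ?_)
    simp [inner_self_eq_norm_sq_to_K]
  rw [inner_self_eq_norm_sq_to_K] at h
  apply Complex.ofReal_injective
  rw [← h]
  push_cast
  rfl

theorem integrable_re_mul_norm_sq {m : Measure E3} {ξ : E3 → ℂ} (hξ : MemLp ξ ⊤ m) (c : ℂ)
    (g : Lp C3 2 m) : Integrable (fun x => (c * ξ x).re * ‖g x‖ ^ 2) m := by
  have h := ((integrable_norm_sq g).ofReal (𝕜 := ℂ)).mul_of_top_right (hξ.const_mul c)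
  refine h.re.congr (Eventually.of_forall fun x => ?_)
  exact Complex.re_mul_ofReal _ _

theorem re_mul_integral {m : Measure E3} {ξ : E3 → ℂ} (hξ : MemLp ξ ⊤ m) (c : ℂ)
    (g : Lp C3 2 m) :
    (c * ∫ x, ξ x * inner ℂ (g x) (g x) ∂m).re = ∫ x, (c * ξ x).re * ‖g x‖ ^ 2 ∂m := by
  have h := ((integrable_norm_sq g).ofReal (𝕜 := ℂ)).mul_of_top_right (hξ.const_mul c)
  have e : c * ∫ x, ξ x * inner ℂ (g x) (g x) ∂m
      = ∫ x, c * ξ x * ((‖g x‖ ^ 2 : ℝ) : ℂ) ∂m := by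
    rw [← integral_const_mul]
    refine integral_congr_ae (Eventually.of_forall fun x => ?_)
    simp [inner_self_eq_norm_sq_to_K, mul_assoc]
  rw [e]
  have h2 := integral_re (𝕜 := ℂ) h
  simp only [RCLike.re_to_complex] at h2
  rw [show (fun x => c * ξ x * ((‖g x‖ ^ 2 : ℝ) : ℂ)) = ((fun x => c * ξ x) *
    fun x => ((‖g x‖ ^ 2 : ℝ) : ℂ)) from rfl]
  refine h2.symm.trans (integral_congr_ae (Eventually.of_forall fun x => ?_))
  simp only [Pi.mul_apply]
  exact Complex.re_mul_ofReal _ _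

theorem mul_norm_sq_le_integral {m : Measure E3} {ξ : E3 → ℂ} (hξ : MemLp ξ ⊤ m) {c : ℂ} {b : ℝ}
    (hb : ∀ᵐ x ∂m, b ≤ (c * ξ x).re) (g : Lp C3 2 m) :
    b * ‖g‖ ^ 2 ≤ ∫ x, (c * ξ x).re * ‖g x‖ ^ 2 ∂m := by
  rw [← integral_norm_sq, ← integral_const_mul]
  refine integral_mono_ae ((integrable_norm_sq g).const_mul b) (integrable_re_mul_norm_sq hξ c g) ?_
  filter_upwards [hb] with x hx
  exact mul_le_mul_of_nonneg_right hx (sq_nonneg _)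

/-- On the diagonal the inner products are squared norms, hence real, so taking the real part acts
only on the rotated coefficients. -/
theorem re_robinForm {Ω : Set E3} {ω : ℝ} {μ : E3 → ℝ} {εc α : E3 → ℂ}
    (hμ : MemLp (fun x => -((μ x)⁻¹ : ℂ)) ⊤ (volume.restrict Ω))
    (hε : MemLp εc ⊤ (volume.restrict Ω)) (hα : MemLp α ⊤ (surfaceMeasure Ω)) (c : ℂ)
    (u : HPlusCurl Ω) :
    (-c * robinForm Ω ω μ εc α u u).re =
      (∫ x in Ω, (c * -((μ x)⁻¹ : ℂ)).re * ‖curlOf u x‖ ^ 2)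
        + ω ^ 2 * (∫ x in Ω, (c * εc x).re * ‖fieldOf u x‖ ^ 2)
        + ∫ x, (c * α x).re * ‖traceOf u x‖ ^ 2 ∂surfaceMeasure Ω := by
  rw [← re_mul_integral hμ, ← re_mul_integral hε, ← re_mul_integral hα, ← Complex.re_ofReal_mul,
    ← Complex.add_re, ← Complex.add_re, robinForm]
  congr 1
  have e : ∫ x in Ω, -((μ x)⁻¹ : ℂ) * inner ℂ (curlOf u x) (curlOf u x)
      = -∫ x in Ω, ((μ x)⁻¹ : ℂ) * inner ℂ (curlOf u x) (curlOf u x) := by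
    rw [← integral_neg]; simp only [neg_mul]
  rw [e]
  push_cast
  ring

theorem memLp_dielectric {Ω : Set E3} (ω : ℝ) {ε σ : E3 → ℝ}
    (hε : MemLp ε ⊤ (volume.restrict Ω)) (hσ : MemLp σ ⊤ (volume.restrict Ω)) :
    MemLp (dielectric ω ε σ) ⊤ (volume.restrict Ω) := by
  have h := (hε.ofReal (K := ℂ)).add ((hσ.ofReal (K := ℂ)).const_mul (Complex.I / ω))
  refine h.ae_eq (Eventually.of_forall fun x => ?_)
  simp [dielectric]
  ring

theorem memLp_neg_inv {m : Measure E3} {μ : E3 → ℝ} (hμ : MemLp μ ⊤ m)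
    (hlow : ∃ c : ℝ, 0 < c ∧ ∀ᵐ x ∂m, c ≤ μ x) : MemLp (fun x => -((μ x)⁻¹ : ℂ)) ⊤ m := by
  obtain ⟨c, hc, hcμ⟩ := hlow
  have hm : AEStronglyMeasurable (fun x => -((μ x)⁻¹ : ℂ)) m :=
    (Complex.measurable_ofReal.comp_aemeasurable hμ.1.aemeasurable).inv.neg.aestronglyMeasurable
  refine memLp_top_of_bound hm c⁻¹ ?_
  filter_upwards [hcμ] with x hx
  rw [norm_neg, norm_inv, Complex.norm_real, Real.norm_of_nonneg (hc.le.trans hx)]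
  exact inv_anti₀ hc hx

theorem exists_bound_of_memLp_top {F : Type*} [NormedAddCommGroup F] {m : Measure E3} {f : E3 → F}
    (hf : MemLp f ⊤ m) : ∃ M : ℝ, 0 < M ∧ ∀ᵐ x ∂m, ‖f x‖ ≤ M := by
  obtain ⟨M, hM⟩ : ∃ M : ℝ, ∀ᵐ x ∂m, ‖f x‖ ≤ M := by
    refine ⟨(eLpNormEssSup f m).toReal, ?_⟩
    have h1 : eLpNormEssSup f m < ⊤ := by simpa using hf.2
    filter_upwards [ae_le_eLpNormEssSup (f := f) (μ := m)] with x hx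
    have := ENNReal.toReal_mono h1.ne hx
    simpa using this
  -- The maximum with 1 makes the bound strictly positive, hence usable as a divisor.
  exact ⟨max M 1, by positivity, hM.mono fun x hx => hx.trans (le_max_left _ _)⟩

/-- Common ellipticity directions of the coefficients are coercivity directions. -/
theorem thetaSet_inter_subset {Ω : Set E3} {ω : ℝ} (hω : 0 < ω) {μ : E3 → ℝ} {εc α : E3 → ℂ}
    (hμ : MemLp (fun x => -((μ x)⁻¹ : ℂ)) ⊤ (volume.restrict Ω))
    (hε : MemLp εc ⊤ (volume.restrict Ω)) (hα : MemLp α ⊤ (surfaceMeasure Ω)) :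
    thetaSet (volume.restrict Ω) εc ∩ thetaSet (volume.restrict Ω) (fun x => -((μ x)⁻¹ : ℂ)) ∩
      thetaSet (surfaceMeasure Ω) α ⊆ coercivityDirections (robinForm Ω ω μ εc α) := by
  rintro θ ⟨⟨⟨hθ, a, ha, hεa⟩, -, b, hb, hμb⟩, -, c, hc, hαc⟩
  refine ⟨hθ, min (min (ω ^ 2 * a) b) c, by positivity, fun u => ?_⟩
  rw [re_robinForm hμ hε hα, HPlusCurl_norm_sq]
  have h1 := mul_norm_sq_le_integral hε hεa (fieldOf u)
  have h2 := mul_norm_sq_le_integral hμ hμb (curlOf u)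
  have h3 := mul_norm_sq_le_integral hα hαc (traceOf u)
  have h1' := mul_le_mul_of_nonneg_left h1 (sq_nonneg ω)
  have m1 : min (min (ω ^ 2 * a) b) c * ‖fieldOf u‖ ^ 2 ≤ ω ^ 2 * a * ‖fieldOf u‖ ^ 2 :=
    mul_le_mul_of_nonneg_right ((min_le_left _ _).trans (min_le_left _ _)) (sq_nonneg _)
  have m2 : min (min (ω ^ 2 * a) b) c * ‖curlOf u‖ ^ 2 ≤ b * ‖curlOf u‖ ^ 2 :=
    mul_le_mul_of_nonneg_right ((min_le_left _ _).trans (min_le_right _ _)) (sq_nonneg _)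
  have m3 : min (min (ω ^ 2 * a) b) c * ‖traceOf u‖ ^ 2 ≤ c * ‖traceOf u‖ ^ 2 :=
    mul_le_mul_of_nonneg_right (min_le_right _ _) (sq_nonneg _)
  linarith

/-! ### Phases, cosines and ellipticity directions. -/

theorem re_exp_mul_polar (θ r φ : ℝ) :
    (Complex.exp (Complex.I * θ) * (r * Complex.exp (Complex.I * φ))).re
      = r * Real.cos (θ + φ) := by
  rw [mul_left_comm, ← Complex.exp_add, Complex.re_ofReal_mul, ← mul_add, ← Complex.ofReal_add,
    mul_comm Complex.I, Complex.exp_ofReal_mul_I_re]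

/-- On `[-π/2, π/2]` the cosine increases up to 0 and decreases afterwards, so its minimum over a
subinterval is at an endpoint. -/
theorem min_cos_le_cos {a b t : ℝ} (ha : -(Real.pi / 2) ≤ a) (hb : b ≤ Real.pi / 2) (hat : a ≤ t)
    (htb : t ≤ b) : min (Real.cos a) (Real.cos b) ≤ Real.cos t := by
  have hpi := Real.pi_pos
  rcases le_total 0 t with h | h
  · exact (min_le_right _ _).trans
      (Real.cos_le_cos_of_nonneg_of_le_pi h (by linarith) htb)
  · refine (min_le_left _ _).trans ?_
    rw [← Real.cos_neg a, ← Real.cos_neg t]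
    exact Real.cos_le_cos_of_nonneg_of_le_pi (by linarith) (by linarith) (by linarith)

/-- The rotated phases fill at most a compact part of `]-π/2, π/2[`, where the cosine is at least
its smaller endpoint value; the lower bound on the modulus does the rest. -/
theorem mem_thetaSet_of_phase {m : Measure E3} {ξ : E3 → ℂ} {φ : E3 → ℝ} {a b θ : ℝ}
    (hθ : θ ∈ Icc (-Real.pi) Real.pi) (hlow : ∃ c : ℝ, 0 < c ∧ ∀ᵐ x ∂m, c ≤ ‖ξ x‖)
    (hφ : ∀ᵐ x ∂m, ξ x = (‖ξ x‖ : ℂ) * Complex.exp (Complex.I * (φ x : ℂ)))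
    (hmem : ∀ᵐ x ∂m, φ x ∈ Icc a b) (hab : a ≤ b) (ha : -(Real.pi / 2) < θ + a)
    (hb : θ + b < Real.pi / 2) : θ ∈ thetaSet m ξ := by
  obtain ⟨c, hc, hcξ⟩ := hlow
  have hpos : 0 < min (Real.cos (θ + a)) (Real.cos (θ + b)) :=
    lt_min (Real.cos_pos_of_mem_Ioo ⟨ha, by linarith⟩)
      (Real.cos_pos_of_mem_Ioo ⟨by linarith, hb⟩)
  refine ⟨hθ, c * min (Real.cos (θ + a)) (Real.cos (θ + b)), by positivity, ?_⟩
  filter_upwards [hcξ, hφ, hmem] with x h1 h2 h3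
  rw [h2, re_exp_mul_polar]
  have h4 := min_cos_le_cos ha.le hb.le (add_le_add_right h3.1 θ) (add_le_add_right h3.2 θ)
  exact mul_le_mul h1 h4 hpos.le (norm_nonneg _)

/-! ### Coercivity directions are ellipticity directions -/

/-- The coercivity constant is absorbed into the weights of the field and of the trace, while the
curl terms stay separate: they vanish for gradients and dominate for rapidly oscillating transverse
fields. -/
theorem le_re_robinForm_of_smooth {Ω : Set E3} [IsFiniteMeasure (volume.restrict Ω)]
    [IsFiniteMeasure (surfaceMeasure Ω)]
    (hn : AEStronglyMeasurable (outwardNormal Ω) (surfaceMeasure Ω))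
    {ω : ℝ} {μ : E3 → ℝ} {εc α : E3 → ℂ}
    (hμ : MemLp (fun x => -((μ x)⁻¹ : ℂ)) ⊤ (volume.restrict Ω))
    (hε : MemLp εc ⊤ (volume.restrict Ω)) (hα : MemLp α ⊤ (surfaceMeasure Ω)) {c : ℂ} {C : ℝ}
    (hC : ∀ u : HPlusCurl Ω, C * ‖u‖ ^ 2 ≤ (-c * robinForm Ω ω μ εc α u u).re)
    {v : E3 → C3} (hv : IsSmoothField v) :
    C * (∫ x in Ω, ‖curl v x‖ ^ 2) ≤ (∫ x in Ω, (c * -((μ x)⁻¹ : ℂ)).re * ‖curl v x‖ ^ 2)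
      + (∫ x in Ω, (ω ^ 2 * (c * εc x).re - C) * ‖v x‖ ^ 2)
      + ∫ x, ((c * α x).re - C) * ‖crossReal (v x) (outwardNormal Ω x)‖ ^ 2
          ∂surfaceMeasure Ω := by
  obtain ⟨u, hu, hw, hg⟩ := exists_HPlusCurl_of_smooth hn hv
  have h := hC u
  rw [re_robinForm hμ hε hα, HPlusCurl_norm_sq] at h
  have e0 : ∫ x in Ω, ‖curl v x‖ ^ 2 = ‖curlOf u‖ ^ 2 := by
    rw [← integral_norm_sq]
    exact integral_congr_ae (hw.mono fun x hx => by simp only [hx])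
  have e1 : ∫ x in Ω, (c * -((μ x)⁻¹ : ℂ)).re * ‖curl v x‖ ^ 2
      = ∫ x in Ω, (c * -((μ x)⁻¹ : ℂ)).re * ‖curlOf u x‖ ^ 2 :=
    integral_congr_ae (hw.mono fun x hx => by simp only [hx])
  have e2 : ∫ x in Ω, (ω ^ 2 * (c * εc x).re - C) * ‖v x‖ ^ 2
      = ω ^ 2 * (∫ x in Ω, (c * εc x).re * ‖fieldOf u x‖ ^ 2) - C * ‖fieldOf u‖ ^ 2 := by
    rw [← integral_norm_sq, ← integral_const_mul, ← integral_const_mul,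
      ← integral_sub ((integrable_re_mul_norm_sq hε c _).const_mul _)
        ((integrable_norm_sq _).const_mul _)]
    refine integral_congr_ae (hu.mono fun x hx => ?_)
    simp only [hx]
    ring
  have e3 : ∫ x, ((c * α x).re - C) * ‖crossReal (v x) (outwardNormal Ω x)‖ ^ 2 ∂surfaceMeasure Ω
      = (∫ x, (c * α x).re * ‖traceOf u x‖ ^ 2 ∂surfaceMeasure Ω) - C * ‖traceOf u‖ ^ 2 := by
    rw [← integral_norm_sq, ← integral_const_mul,
      ← integral_sub (integrable_re_mul_norm_sq hα c _) ((integrable_norm_sq _).const_mul _)]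
    refine integral_congr_ae (hg.mono fun x hx => ?_)
    simp only [hx]
    ring
  rw [e0, e1, e2, e3]
  linarith

theorem integrable_re_mul {m : Measure E3} [IsFiniteMeasure m] {ξ : E3 → ℂ} (hξ : MemLp ξ ⊤ m)
    (c : ℂ) : Integrable (fun x => (c * ξ x).re) m :=
  ((hξ.const_mul c).integrable le_top).re

/-- A coercivity direction is an ellipticity direction of `εc` and of `α`. -/
theorem ae_le_re_of_coercive {Ω : Set E3} (hΩ : IsOpen Ω) [IsFiniteMeasure (volume.restrict Ω)]
    [IsFiniteMeasure (surfaceMeasure Ω)]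
    (hn : AEStronglyMeasurable (outwardNormal Ω) (surfaceMeasure Ω))
    (hn1 : ∀ᵐ x ∂surfaceMeasure Ω, ‖outwardNormal Ω x‖ = 1)
    {ω : ℝ} {μ : E3 → ℝ} {εc α : E3 → ℂ}
    (hμ : MemLp (fun x => -((μ x)⁻¹ : ℂ)) ⊤ (volume.restrict Ω))
    (hε : MemLp εc ⊤ (volume.restrict Ω)) (hα : MemLp α ⊤ (surfaceMeasure Ω)) {c : ℂ} {C : ℝ}
    (hC : ∀ u : HPlusCurl Ω, C * ‖u‖ ^ 2 ≤ (-c * robinForm Ω ω μ εc α u u).re) :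
    (∀ᵐ x ∂volume.restrict Ω, C ≤ ω ^ 2 * (c * εc x).re) ∧
      ∀ᵐ x ∂surfaceMeasure Ω, C ≤ (c * α x).re := by
  have h := ae_nonneg_of_curl_free hΩ hn hn1
    (f := fun x => ω ^ 2 * (c * εc x).re - C) (g := fun x => (c * α x).re - C)
    (((integrable_re_mul hε c).const_mul _).sub (integrable_const C))
    ((integrable_re_mul hα c).sub (integrable_const C)) fun v hv hcurl => by
      simpa [hcurl] using le_re_robinForm_of_smooth hn hμ hε hα hC hv
  exact ⟨h.1.mono fun x hx => by linarith, h.2.mono fun x hx => by linarith⟩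

/-- The field `ψ exp(i N x₀) e₁`. -/
def transverseField (ψ : E3 → ℝ) (N : ℝ) (x : E3) : C3 :=
  !₂[0, (ψ x : ℂ) * planeWave N 0 x, 0]

theorem isSmoothField_transverseField {ψ : E3 → ℝ}
    (hψ : ContDiff ℝ ((⊤ : ℕ∞) : WithTop ℕ∞) ψ) (hc : HasCompactSupport ψ) (N : ℝ) :
    IsSmoothField (transverseField ψ N) := by
  constructor
  · refine (contDiff_piLp 2).2 fun i => ?_
    fin_cases i
    · exact contDiff_const
    · exact (contDiff_ofReal_comp hψ).mul (contDiff_planeWave N 0)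
    · exact contDiff_const
  · refine hc.mono fun x hx => ?_
    rw [Function.mem_support] at hx ⊢
    contrapose! hx
    ext i
    fin_cases i <;> simp [transverseField, hx]

theorem norm_transverseField_sq (ψ : E3 → ℝ) (N : ℝ) (x : E3) :
    ‖transverseField ψ N x‖ ^ 2 = ψ x ^ 2 := by
  simp [EuclideanSpace.norm_sq_eq, Fin.sum_univ_three, transverseField, norm_planeWave]

/-- The third component of the curl suffices: up to a phase its real part is `∂₀ψ` and its imaginary
part `Nψ`, so the derivative of the cutoff cannot cancel the oscillation. -/
theorem le_norm_curl_transverseField_sq {ψ : E3 → ℝ}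
    (hψ : ContDiff ℝ ((⊤ : ℕ∞) : WithTop ℕ∞) ψ) (hc : HasCompactSupport ψ) (N : ℝ) (x : E3) :
    N ^ 2 * ψ x ^ 2 ≤ ‖curl (transverseField ψ N) x‖ ^ 2 := by
  have hv := isSmoothField_transverseField hψ hc N
  have h2 : curl (transverseField ψ N) x 2 = planeWave N 0 x *
      ((fderiv ℝ ψ x (EuclideanSpace.single 0 1) : ℂ) + Complex.I * ((N * ψ x : ℝ) : ℂ)) := by
    have e1 := fderiv_coord hv 0 1 x
    have e0 := fderiv_coord hv 1 0 x
    simp only [transverseField] at e0 e1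
    simp at e0 e1
    rw [fderiv_mul_planeWave hψ] at e1
    simp only [curl]
    simp [← e0, ← e1]
  calc N ^ 2 * ψ x ^ 2 ≤ ‖curl (transverseField ψ N) x 2‖ ^ 2 := by
        rw [h2, norm_mul, norm_planeWave, one_mul, Complex.sq_norm, Complex.normSq_apply]
        simp
        nlinarith [sq_nonneg (fderiv ℝ ψ x (EuclideanSpace.single 0 1))]
    _ ≤ ‖curl (transverseField ψ N) x‖ ^ 2 :=
        pow_le_pow_left₀ (norm_nonneg _) (PiLp.norm_apply_le _ _) 2

/-- A coercivity direction is an ellipticity direction of negative reals. -/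
theorem re_neg_of_coercive {Ω : Set E3} (hΩ : IsOpen Ω) (hne : Ω.Nonempty)
    [IsFiniteMeasure (volume.restrict Ω)] [IsFiniteMeasure (surfaceMeasure Ω)]
    (hn : AEStronglyMeasurable (outwardNormal Ω) (surfaceMeasure Ω))
    {ω : ℝ} {μ : E3 → ℝ} {εc α : E3 → ℂ}
    (hμ : MemLp (fun x => -((μ x)⁻¹ : ℂ)) ⊤ (volume.restrict Ω))
    (hμ_pos : ∀ᵐ x ∂volume.restrict Ω, 0 < μ x)
    (hε : MemLp εc ⊤ (volume.restrict Ω)) (hα : MemLp α ⊤ (surfaceMeasure Ω)) {c : ℂ} {C : ℝ}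
    (hC0 : 0 < C)
    (hC : ∀ u : HPlusCurl Ω, C * ‖u‖ ^ 2 ≤ (-c * robinForm Ω ω μ εc α u u).re) : c.re < 0 := by
  by_contra! hre
  obtain ⟨x₀, hx₀⟩ := hne
  obtain ⟨ψ, hsupp, hc, hψ, -, hψ1⟩ := exists_contDiff_tsupport_subset (n := ⊤) (hΩ.mem_nhds hx₀)
  obtain ⟨M, hM0, hM⟩ := exists_bound_of_memLp_top (hε.const_mul c)
  have hz : ∀ x, x ∉ Ω → ψ x = 0 := fun x hx =>
    image_eq_zero_of_notMem_tsupport fun h => hx (hsupp h)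
  have hsq : Continuous fun x => ψ x ^ 2 := hψ.continuous.pow 2
  have hsqc : HasCompactSupport fun x => ψ x ^ 2 :=
    hc.comp_left (g := fun t : ℝ => t ^ 2) (by simp)
  have hint : Integrable (fun x => ψ x ^ 2) (volume.restrict Ω) :=
    hsq.integrable_of_hasCompactSupport hsqc
  have hpos : 0 < ∫ x in Ω, ψ x ^ 2 := by
    rw [setIntegral_eq_integral_of_forall_compl_eq_zero fun x hx => by simp [hz x hx]]
    exact hsq.integral_pos_of_hasCompactSupport_nonneg_nonzero hsqc (fun x => sq_nonneg _)
      (x := x₀) (by simp [hψ1])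
  -- If `Re c ≥ 0`, the curl term of the form has the wrong sign, so the mass term alone would have
  -- to control a curl energy growing like `N²`. The trace vanishes because the cutoff is supported
  -- in `Ω`.
  have hbound : ∀ N : ℕ, C * ((N : ℝ) ^ 2 * ∫ x in Ω, ψ x ^ 2) ≤ (ω ^ 2 * M) * ∫ x in Ω, ψ x ^ 2 := by
    intro N
    have hv := isSmoothField_transverseField hψ hc N
    have h := le_re_robinForm_of_smooth hn hμ hε hα hC hv
    have h1 : ∫ x in Ω, (c * -((μ x)⁻¹ : ℂ)).re * ‖curl (transverseField ψ N) x‖ ^ 2 ≤ 0 := by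
      refine integral_nonpos_of_ae ?_
      filter_upwards [hμ_pos] with x hx
      have : (c * -((μ x)⁻¹ : ℂ)).re = -(c.re * (μ x)⁻¹) := by
        rw [← Complex.ofReal_inv, mul_neg, Complex.neg_re, Complex.re_mul_ofReal]
      rw [this]
      have : 0 ≤ c.re * (μ x)⁻¹ * ‖curl (transverseField ψ N) x‖ ^ 2 := by positivity
      simpa using this
    have h2 : ∫ x in Ω, (ω ^ 2 * (c * εc x).re - C) * ‖transverseField ψ N x‖ ^ 2
        ≤ (ω ^ 2 * M) * ∫ x in Ω, ψ x ^ 2 := by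
      simp only [norm_transverseField_sq]
      rw [← integral_const_mul]
      obtain ⟨M', hM'⟩ := hsqc.exists_bound_of_continuous hsq
      refine integral_mono_ae (integrable_mul_of_bound
        (((integrable_re_mul hε c).const_mul _).sub (integrable_const C))
        hsq.aestronglyMeasurable hM') (hint.const_mul _) ?_
      filter_upwards [hM] with x hx
      refine mul_le_mul_of_nonneg_right ?_ (sq_nonneg _)
      have h3 := mul_le_mul_of_nonneg_left ((Complex.re_le_norm (c * εc x)).trans hx) (sq_nonneg ω)
      linarith
    have h3 : ∫ x, ((c * α x).re - C) *
        ‖crossReal (transverseField ψ N x) (outwardNormal Ω x)‖ ^ 2 ∂surfaceMeasure Ω = 0 := by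
      refine integral_eq_zero_of_ae ?_
      filter_upwards [ae_restrict_mem isClosed_frontier.measurableSet] with x hx
      rw [hΩ.frontier_eq] at hx
      have h0 : transverseField ψ N x = 0 := by
        rw [← norm_eq_zero, ← sq_eq_zero_iff, norm_transverseField_sq, hz x hx.2]
        simp
      have : ‖crossReal (transverseField ψ N x) (outwardNormal Ω x)‖ = 0 :=
        le_antisymm ((norm_crossReal_le _ _).trans (by simp [h0])) (norm_nonneg _)
      simp [this]
    have h4 : (N : ℝ) ^ 2 * ∫ x in Ω, ψ x ^ 2 ≤ ∫ x in Ω, ‖curl (transverseField ψ N) x‖ ^ 2 := by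
      rw [← integral_const_mul]
      refine integral_mono (hint.const_mul _) ?_
        fun x => le_norm_curl_transverseField_sq hψ hc N x
      exact (memLp_two_iff_integrable_sq_norm hv.curl.continuous.aestronglyMeasurable).1
        (hv.curl.memLp _)
    have h5 := mul_le_mul_of_nonneg_left h4 hC0.le
    linarith
  -- With `N > 1` and `C N > ω² M`, one gets `C N² > C N > ω² M`, against the bound.
  obtain ⟨N, hN⟩ := exists_nat_gt (max 1 (ω ^ 2 * M / C))
  have hN1 : (1 : ℝ) < N := (le_max_left _ _).trans_lt hN
  have hN2 : ω ^ 2 * M / C < N := (le_max_right _ _).trans_lt hN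
  rw [div_lt_iff₀ hC0] at hN2
  have h6 := hbound N
  rw [← mul_assoc] at h6
  have h7 := le_of_mul_le_mul_right h6 hpos
  have h8 : 0 < C * N * (N - 1) := by
    have := sub_pos.2 hN1
    positivity
  nlinarith

/-- If `cos (θ + φ)` has an essential positive lower bound, then so has the distance of `θ + φ`
to `±π/2`. -/
theorem exists_gap_of_cos {m : Measure E3} {φ : E3 → ℝ} {θ b : ℝ} (hb : 0 < b)
    (hcos : ∀ᵐ x ∂m, b ≤ Real.cos (θ + φ x))
    (hmem : ∀ᵐ x ∂m, θ + φ x ∈ Ioo (-Real.pi) Real.pi) :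
    ∃ δ : ℝ, 0 < δ ∧ (∀ᵐ x ∂m, -(Real.pi / 2) - θ + δ ≤ φ x) ∧
      ∀ᵐ x ∂m, φ x ≤ Real.pi / 2 - θ - δ := by
  have hpi := Real.pi_pos
  have hδ : 0 < min b 1 := by positivity
  have habs : ∀ᵐ x ∂m, |θ + φ x| ≤ Real.pi / 2 - min b 1 := by
    filter_upwards [hcos, hmem] with x h1 h2
    -- The range hypothesis excludes the other periods on which the cosine is positive.
    have h3 : |θ + φ x| ≤ Real.pi := abs_le.2 ⟨h2.1.le, h2.2.le⟩
    rw [← Real.cos_abs] at h1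
    have h4 : |θ + φ x| < Real.pi / 2 := by
      by_contra! h
      have := Real.cos_nonpos_of_pi_div_two_le_of_le h (by linarith)
      linarith
    -- The width of the gap comes from `b ≤ cos s = sin(π/2 - |s|) ≤ π/2 - |s|`.
    rw [← Real.sin_pi_div_two_sub] at h1
    have h5 := Real.sin_le (show 0 ≤ Real.pi / 2 - |θ + φ x| by linarith)
    linarith [min_le_left b 1]
  refine ⟨_, hδ, habs.mono fun x hx => ?_, habs.mono fun x hx => ?_⟩
  · linarith [(abs_le.1 hx).1]
  · linarith [(abs_le.1 hx).2]

/-- The modulus is bounded above, so a lower bound on `|ξ| cos(θ + φ)` can be divided by it once the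
cosine is known to be positive. -/
theorem exists_le_cos_of_le_re {m : Measure E3} {ξ : E3 → ℂ} (hξ : MemLp ξ ⊤ m) {φ : E3 → ℝ}
    {θ C : ℝ} (hC : 0 < C)
    (hφ : ∀ᵐ x ∂m, ξ x = (‖ξ x‖ : ℂ) * Complex.exp (Complex.I * (φ x : ℂ)))
    (h : ∀ᵐ x ∂m, C ≤ (Complex.exp (Complex.I * (θ : ℂ)) * ξ x).re) :
    ∃ b : ℝ, 0 < b ∧ ∀ᵐ x ∂m, b ≤ Real.cos (θ + φ x) := by
  obtain ⟨M, hM0, hM⟩ := exists_bound_of_memLp_top hξ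
  refine ⟨C / M, by positivity, ?_⟩
  filter_upwards [hφ, h, hM] with x h1 h2 h3
  rw [h1, re_exp_mul_polar] at h2
  have h4 : 0 < Real.cos (θ + φ x) := by
    by_contra! h5
    have := mul_nonpos_of_nonneg_of_nonpos (norm_nonneg (ξ x)) h5
    linarith
  rw [div_le_iff₀ hM0, mul_comm]
  exact h2.trans (mul_le_mul_of_nonneg_right h3 h4.le)

theorem ae_pos_of_low {m : Measure E3} {μ : E3 → ℝ}
    (hlow : ∃ c : ℝ, 0 < c ∧ ∀ᵐ x ∂m, c ≤ μ x) : ∀ᵐ x ∂m, 0 < μ x :=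
  let ⟨_, hc, h⟩ := hlow
  h.mono fun _ hx => hc.trans_le hx

/-- Here `cos θ < 0`, and the upper bound on `μ` keeps `1/μ` away from zero. -/
theorem mem_thetaSet_neg_inv {m : Measure E3} {μ : E3 → ℝ} (hμ : MemLp μ ⊤ m)
    (hpos : ∀ᵐ x ∂m, 0 < μ x) {θ : ℝ} (hθ : θ ∈ Icc (-Real.pi) Real.pi)
    (h : θ < -(Real.pi / 2)) : θ ∈ thetaSet m (fun x => -((μ x)⁻¹ : ℂ)) := by
  obtain ⟨M, hM0, hM⟩ := exists_bound_of_memLp_top hμ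
  have hcos : 0 < -Real.cos θ := by
    rw [← Real.cos_neg, Left.neg_pos_iff]
    exact Real.cos_neg_of_pi_div_two_lt_of_lt (by linarith) (by linarith [hθ.1, Real.pi_pos])
  refine ⟨hθ, -Real.cos θ * M⁻¹, by positivity, ?_⟩
  filter_upwards [hpos, hM] with x h1 h2
  have e : (Complex.exp (Complex.I * (θ : ℂ)) * -((μ x)⁻¹ : ℂ)).re = -Real.cos θ * (μ x)⁻¹ := by
    rw [← Complex.ofReal_inv, mul_neg, Complex.neg_re, Complex.re_mul_ofReal,
      mul_comm Complex.I, Complex.exp_ofReal_mul_I_re, neg_mul]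
  rw [e]
  exact mul_le_mul_of_nonneg_left (inv_anti₀ h1 ((le_abs_self _).trans h2)) hcos.le

end Maxwell
end

theorem mainTheorem4
    -- the domain
    (Ω : Set E3) (hΩ_open : IsOpen Ω) (hΩ_conn : IsConnected Ω)
    (hΩ_bdd : Bornology.IsBounded Ω) (hΩ_lip : HasLipschitzBoundary Ω)
    -- the frequency and the bounded coefficients
    (ω : ℝ) (hω : 0 < ω) (ε σ μ : E3 → ℝ) (α : E3 → ℂ)
    (hε : MemLp ε ⊤ (volume.restrict Ω)) (hσ : MemLp σ ⊤ (volume.restrict Ω))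
    (hμ : MemLp μ ⊤ (volume.restrict Ω)) (hα : MemLp α ⊤ (surfaceMeasure Ω))
    (hε_pos : ∀ᵐ x ∂volume.restrict Ω, 0 < ε x) (hσ_pos : ∀ᵐ x ∂volume.restrict Ω, 0 < σ x)
    -- `μ`, `ε_c` and `α` are bounded away from zero
    (hμ_low : ∃ c : ℝ, 0 < c ∧ ∀ᵐ x ∂volume.restrict Ω, c ≤ μ x)
    (hε_low : ∃ c : ℝ, 0 < c ∧ ∀ᵐ x ∂volume.restrict Ω, c ≤ ‖dielectric ω ε σ x‖)
    (hα_low : ∃ c : ℝ, 0 < c ∧ ∀ᵐ x ∂surfaceMeasure Ω, c ≤ ‖α x‖)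
    -- the phases and their bounds
    (φε φα : E3 → ℝ) (φεm φεp φαm φαp : ℝ)
    (hφε : ∀ᵐ x ∂volume.restrict Ω, dielectric ω ε σ x =
      (‖dielectric ω ε σ x‖ : ℂ) * Complex.exp (Complex.I * (φε x : ℂ)))
    (hφα : ∀ᵐ x ∂surfaceMeasure Ω, α x =
      (‖α x‖ : ℂ) * Complex.exp (Complex.I * (φα x : ℂ)))
    (hφε_mem : ∀ᵐ x ∂volume.restrict Ω, φε x ∈ Set.Icc φεm φεp)
    (hφα_mem : ∀ᵐ x ∂surfaceMeasure Ω, φα x ∈ Set.Icc φαm φαp)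
    (hε1 : 0 < φεm) (hε2 : φεm ≤ φεp) (hε3 : φεp < Real.pi / 2)
    (hα1 : 0 < φαm) (hα2 : φαm ≤ φαp) (hα3 : φαp < Real.pi + φεm)
    (hα4 : φαp - φαm < Real.pi) :
    -- the interval consists of coercivity directions of the Robin form
    Set.Ioo (-(Real.pi / 2) - min φεm φαm) (-(Real.pi / 2) - max 0 (φαp - Real.pi)) ⊆
        coercivityDirections (robinForm Ω ω μ (dielectric ω ε σ) α) ∧
    -- it is contained in the intersection of the `Θ`-sets, which also gives coercivity directions
    Set.Ioo (-(Real.pi / 2) - min φεm φαm) (-(Real.pi / 2) - max 0 (φαp - Real.pi)) ⊆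
        thetaSet (volume.restrict Ω) (dielectric ω ε σ) ∩
          thetaSet (volume.restrict Ω) (fun x => -((μ x)⁻¹ : ℂ)) ∩
          thetaSet (surfaceMeasure Ω) α ∧
    thetaSet (volume.restrict Ω) (dielectric ω ε σ) ∩
          thetaSet (volume.restrict Ω) (fun x => -((μ x)⁻¹ : ℂ)) ∩
          thetaSet (surfaceMeasure Ω) α ⊆
        coercivityDirections (robinForm Ω ω μ (dielectric ω ε σ) α) ∧
    -- equality if the bounds are attained
    (IsEssMin (volume.restrict Ω) φε φεm → IsEssMin (surfaceMeasure Ω) φα φαm →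
      IsEssMax (surfaceMeasure Ω) φα φαp →
        coercivityDirections (robinForm Ω ω μ (dielectric ω ε σ) α) =
          Set.Ioo (-(Real.pi / 2) - min φεm φαm) (-(Real.pi / 2) - max 0 (φαp - Real.pi)) ∧
        thetaSet (volume.restrict Ω) (dielectric ω ε σ) ∩
            thetaSet (volume.restrict Ω) (fun x => -((μ x)⁻¹ : ℂ)) ∩
            thetaSet (surfaceMeasure Ω) α =
          Set.Ioo (-(Real.pi / 2) - min φεm φαm) (-(Real.pi / 2) - max 0 (φαp - Real.pi))) := by
  have hpi := Real.pi_pos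
  have hεm := memLp_dielectric ω hε hσ
  have hμm := memLp_neg_inv hμ hμ_low
  have hsub2 := thetaSet_inter_subset hω hμm hεm hα
  have hsub1 : Set.Ioo (-(Real.pi / 2) - min φεm φαm) (-(Real.pi / 2) - max 0 (φαp - Real.pi)) ⊆
      thetaSet (volume.restrict Ω) (dielectric ω ε σ) ∩
        thetaSet (volume.restrict Ω) (fun x => -((μ x)⁻¹ : ℂ)) ∩
        thetaSet (surfaceMeasure Ω) α := by
    rintro θ ⟨h1, h2⟩
    have hm1 := min_le_left φεm φαm
    have hm2 := min_le_right φεm φαm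
    have hM1 := le_max_left 0 (φαp - Real.pi)
    have hM2 := le_max_right 0 (φαp - Real.pi)
    -- The lower bound `-π` follows from `min φεm φαm ≤ φεp < π/2`.
    have hθ : θ ∈ Set.Icc (-Real.pi) Real.pi := ⟨by linarith, by linarith⟩
    exact ⟨⟨mem_thetaSet_of_phase hθ hε_low hφε hφε_mem hε2 (by linarith) (by linarith),
        mem_thetaSet_neg_inv hμ (ae_pos_of_low hμ_low) hθ (by linarith)⟩,
      mem_thetaSet_of_phase hθ hα_low hφα hφα_mem hα2 (by linarith) (by linarith)⟩
  refine ⟨hsub1.trans hsub2, hsub1, hsub2, fun hmε hmα hMα => ?_⟩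
  have hsub3 : coercivityDirections (robinForm Ω ω μ (dielectric ω ε σ) α) ⊆
      Set.Ioo (-(Real.pi / 2) - min φεm φαm) (-(Real.pi / 2) - max 0 (φαp - Real.pi)) := by
    rintro θ ⟨hθ, C, hC0, hC⟩
    have : IsFiniteMeasure (volume.restrict Ω) := ⟨by simpa using hΩ_bdd.measure_lt_top⟩
    have := isFiniteMeasure_surfaceMeasure hΩ_open hΩ_bdd hΩ_lip
    obtain ⟨-, hn1, hn⟩ := hasGoodNormalOn_frontier hΩ_open hΩ_bdd hΩ_lip
    have hcos := re_neg_of_coercive hΩ_open hΩ_conn.nonempty hn hμm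
      (ae_pos_of_low hμ_low) hεm hα hC0 hC
    obtain ⟨hεC, hαC⟩ := ae_le_re_of_coercive hΩ_open hn hn1 hμm hεm hα hC
    rw [mul_comm Complex.I, Complex.exp_ofReal_mul_I_re] at hcos
    obtain ⟨b, hb, hεcos⟩ := exists_le_cos_of_le_re hεm (C := C / ω ^ 2) (by positivity) hφε
      (hεC.mono fun x hx => by rwa [div_le_iff₀' (by positivity)])
    obtain ⟨b', hb', hαcos⟩ := exists_le_cos_of_le_re hα hC0 hφα hαC
    have hθ2 : θ < -(Real.pi / 2) := by
      have h1 : ¬(-(Real.pi / 2) ≤ θ ∧ θ ≤ Real.pi / 2) := fun h =>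
        hcos.not_ge (Real.cos_nonneg_of_neg_pi_div_two_le_of_le h.1 h.2)
      by_contra! h2
      have h3 : Real.pi / 2 < θ := by
        by_contra! h3
        exact h1 ⟨h2, h3⟩
      -- For `θ > π/2` the sum `θ + φε` lies between `π/2` and `3π/2`, where the cosine cannot be
      -- positive. The increment 1 is arbitrary: from this pointwise contradiction any lower bound
      -- follows, and one above `φεm` violates its extremality.
      have h4 : ∀ᵐ x ∂volume.restrict Ω, φεm + 1 ≤ φε x := by
        filter_upwards [hεcos, hφε_mem] with x h5 h6
        have h7 := Real.cos_nonpos_of_pi_div_two_le_of_le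
          (show Real.pi / 2 ≤ θ + φε x by linarith [h6.1])
          (by linarith [h6.2, hθ.2])
        linarith
      linarith [hmε.2 h4]
    obtain ⟨δ, hδ, hε_gap, -⟩ := exists_gap_of_cos hb hεcos (hφε_mem.mono fun x hx =>
      ⟨by linarith [hx.1, hθ.1], by linarith [hx.2]⟩)
    -- Extremality transfers the gap to `φεm` itself; the strict positivity of `δ` is what makes the
    -- endpoint of the interval open.
    have h1 := hmε.2 hε_gap
    -- The upper limit `θ + φα < π` holds because `θ < -π/2` and `φαp < π + φεm < 3π/2`.
    obtain ⟨δ', hδ', hα_low', hα_up⟩ := exists_gap_of_cos hb' hαcos (hφα_mem.mono fun x hx =>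
      ⟨by linarith [hx.1, hθ.1], by linarith [hx.2]⟩)
    have h2 := hmα.2 hα_low'
    have h3 := hMα.2 hα_up
    constructor
    · have : -(Real.pi / 2) - θ < min φεm φαm := lt_min (by linarith) (by linarith)
      linarith
    · have : max 0 (φαp - Real.pi) < -(Real.pi / 2) - θ := max_lt (by linarith) (by linarith)
      linarith
  exact ⟨hsub3.antisymm (hsub1.trans hsub2), (hsub2.trans hsub3).antisymm hsub1⟩
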